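/- **Setting.** Let $T\ge 1$ be an integer, $U\subset\mathbb R^k$ non-empty and compact, $f_Y:\mathbb R^d\times U\times\mathbb R\to\mathbb R^d$ continuous, $\ell:\mathbb R^d\to\mathbb R$ Borel measurable, $c_0>0$. Let $\mathscr P(\mathbb R)$ be the space of Borel probability measures on $\mathbb R$ with the Borel $\sigma$-algebra of weak convergence, and $E_X=\mathbb R^d\times\mathscr P(\mathbb R)$. For $x=(y,P)\in E_X$, $u\in U$, $z\in\mathbb R$ and $t=0,\dots,T-1$ put $$\mathbf G(t,x,u,z)=\Bigl(f_Y(y,u,z),\ \frac{(c_0+t)P+\delta_z}{c_0+t+1}\Bigr),\qquad Q(B\mid t,x,u)=\int p\bigl(\{z:\mathbf G(t,x,u,z)\in B\}\bigr)\,\pi(dp),$$ where $\pi$ is the law on $\mathscr P(\mathbb R)$ of the Dirichlet process with parameter $(c_0+t)P$. A policy is a sequence $\varphi=(\varphi_0,\dots,\varphi_{T-1})$ of universally measurable functions $\varphi_t:E_X\to U$; $\mathcal U$ is the set of policies. For $x_0\in E_X$ let $\mathbb Q^{\varphi}_{c_0,x_0}$ be the law on $E_X^{T+1}$ of $(X_0,\dots,X_T)$,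 $X_t=(Y_t,\mathcal P_t)$, given by $\delta_{x_0}(dx_0')\prod_{t=1}^{T}Q(dx_t\mid t-1,x_{t-1},\varphi_{t-1}(x_{t-1}))$. For $t\le T$ and $x\in E_X$ let $\mathbb Q^{\varphi}_{t,x}$ be the law of $(X_{t+1},\dots,X_T)$ given by $\prod_{s=t+1}^{T}Q(dx_s\mid s-1,x_{s-1},\varphi_{s-1}(x_{s-1}))$ with $x_t=x$. Integrals of extended-real functions are $\int g=\int g^+-\int g^-$ with $\infty-\infty=\infty$. Put $$V_t(x,\varphi)=\mathbb E_{\mathbb Q^{\varphi}_{t,x}}[\ell(Y_T)],\qquad V^*_t(x)=\inf_{\varphi\in\mathcal U}V_t(x,\varphi)\qquad(V_T(x,\varphi)=V^*_T(x)=\ell(y)),$$ and define $W_t:E_X\to[-\infty,\infty]$ by the Bellman recursion $$W_T(x)=\ell(y),\qquad W_t(x)=\inf_{u\in U}\mathbb E_P\bigl[W_{t+1}(\mathbf G(t,x,u,Z))\bigr],\quad x=(y,P),\ Z\sim P,\ t=T-1,\dots,0.$$ Call $(t,x)$ well posed if either $\mathbb E_{\mathbb Q^{\varphi}_{t,x}}[\ell(Y_T)^+]<\infty$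 for every policy $\varphi$, or $\sup_{\varphi}\mathbb E_{\mathbb Q^{\varphi}_{t,x}}[\ell(Y_T)^-]<\infty$. (Every $(t,x)$ is well posed if $\ell$ is bounded from below or from above.) **Theorem.** 1. For every $x_0\in E_X$ such that $(0,x_0)$ is well posed, $$\inf_{\varphi\in\mathcal U}\mathbb E_{\mathbb Q^{\varphi}_{c_0,x_0}}[\ell(Y_T)]=V^*_0(x_0)=W_0(x_0),$$ and $V^*_t(x)=W_t(x)$ for every $t\le T$ and every $x\in E_X$ such that $(t,x)$ is well posed. 2. Let $\varphi^*$ be a policy made of universally measurable selectors in the Bellman equations, that is, $$\mathbb E_P\bigl[W_{t+1}(\mathbf G(t,x,\varphi^*_t(x),Z))\bigr]=W_t(x)\qquad\text{for all }t<T,\ x=(y,P)\in E_X.$$ Then $\varphi^*$ attains the infimum in 1 for every $x_0$ such that $(0,x_0)$ is well posed, and $V_t(x,\varphi^*)=V^*_t(x)=W_t(x)$ for every $t\le T$ and every $x\in E_X$ such that $(t,x)$ is well posed. 3. Such universally measurable selectors $\varphi^*$ exist whenever the infimum over $U$ in the Bellman recursion is attained for every $t<T$ and every $x\in E_X$. 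-/

import Mathlib

open MeasureTheory ProbabilityTheory
open scoped NNReal ENNReal

noncomputable section

namespace BayesControl

/-- The extended-real integral `∫ f⁺ dμ - ∫ f⁻ dμ` of an extended-real function, with the
convention `∞ - ∞ = ∞` that is usual in stochastic control on Borel spaces. -/
def eintegral {α : Type*} [MeasurableSpace α] (μ : Measure α) (f : α → EReal) : EReal :=
  if ∫⁻ a, (f a).toENNReal ∂μ = ⊤ then ⊤
  else ((∫⁻ a, (f a).toENNReal ∂μ : ℝ≥0∞) : EReal)
    - ((∫⁻ a, (-(f a)).toENNReal ∂μ : ℝ≥0∞) : EReal)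

/-- `f` is universally measurable: preimages of measurable sets are measurable for the completion
of every probability measure. -/
def UniversallyMeasurable {α β : Type*} [MeasurableSpace α] [MeasurableSpace β]
    (f : α → β) : Prop :=
  ∀ μ : Measure α, IsProbabilityMeasure μ → NullMeasurable f μ

/-! ### Dirichlet distributions and Dirichlet processes -/

/-- The Dirichlet distribution with parameters `a i ≥ 0`, not all zero: the law of
`(Z i / ∑ j, Z j)` for independent `Z i`, where `Z i` has the Gamma distribution with shape `a i`
and rate `1` if `a i > 0`, and `Z i = 0` if `a i = 0`. -/
def dirichletDistribution {n : ℕ} (a : Fin n → ℝ) : Measure (Fin n → ℝ) :=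
  (Measure.pi fun i => if a i = 0 then Measure.dirac (0 : ℝ) else gammaMeasure (a i) 1).map
    fun z i => z i / ∑ j, z j

/-- `π` is the law of a Dirichlet process on `ℝ` with parameter the finite measure `α`: the values
of the random probability measure on any finite measurable partition `B` of `ℝ` have jointly the
Dirichlet distribution with parameters `α (B i)`. (The `σ`-algebra on `ProbabilityMeasure ℝ` is
the one generated by the evaluations at Borel sets; it is the Borel `σ`-algebra of the topology of
weak convergence.) -/
def IsDirichletProcess (α : Measure ℝ) (π : Measure (ProbabilityMeasure ℝ)) : Prop :=
  IsProbabilityMeasure π ∧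
    ∀ (n : ℕ) (B : Fin n → Set ℝ), (∀ i, MeasurableSet (B i)) →
      Pairwise (fun i j => Disjoint (B i) (B j)) → (⋃ i, B i) = Set.univ →
      π.map (fun (p : ProbabilityMeasure ℝ) i => ((p : Measure ℝ) (B i)).toReal)
        = dirichletDistribution fun i => (α (B i)).toReal

open Classical in
/-- The law of the Dirichlet process with parameter `c • P`, `c > 0`. For `c > 0` it exists and is
unique, so the second branch only serves to make the definition total. -/
def dirichletProcess (c : ℝ≥0) (P : ProbabilityMeasure ℝ) : Measure (ProbabilityMeasure ℝ) :=
  if h : ∃ π, IsDirichletProcess (c • (P : Measure ℝ)) π then h.choose else Measure.dirac P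

/-! ### The controlled, augmented process -/

/-- The augmented state space `ℝᵈ × 𝒫(ℝ)`. -/
abbrev State (d : ℕ) : Type := EuclideanSpace ℝ (Fin d) × ProbabilityMeasure ℝ

/-- The update `((c₀ + t) P + δ_z) / (c₀ + t + 1)` of the posterior mean measure. -/
def posteriorMean (c₀ : ℝ≥0) (t : ℕ) (P : ProbabilityMeasure ℝ) (z : ℝ) :
    ProbabilityMeasure ℝ :=
  ⟨(c₀ + t + 1)⁻¹ • ((c₀ + t) • (P : Measure ℝ) + Measure.dirac z), by
    constructor
    have h : (c₀ + t + 1 : ℝ≥0) ≠ 0 := by positivity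
    simp only [Measure.smul_apply, Measure.add_apply, measure_univ, ENNReal.smul_def,
      smul_eq_mul, mul_one]
    rw [← ENNReal.coe_one, ← ENNReal.coe_add, ← ENNReal.coe_mul, inv_mul_cancel₀ h]⟩

variable {d k : ℕ} {U : Set (EuclideanSpace ℝ (Fin k))}

/-- The dynamics of the augmented state,
`G(t, (y, P), u, z) = (f(y, u, z), ((c₀ + t) P + δ_z) / (c₀ + t + 1))`. -/
def stateUpdate (f : EuclideanSpace ℝ (Fin d) → U → ℝ → EuclideanSpace ℝ (Fin d)) (c₀ : ℝ≥0)
    (t : ℕ) (x : State d) (u : U) (z : ℝ) : State d :=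
  (f x.1 u z, posteriorMean c₀ t x.2 z)

/-- The transition law `Q(B | t, x, u) = ∫ p {z | G(t, x, u, z) ∈ B} π(dp)`, where `π` is the
Dirichlet process with parameter `(c₀ + t) P` and `x = (y, P)`. -/
def transition (f : EuclideanSpace ℝ (Fin d) → U → ℝ → EuclideanSpace ℝ (Fin d)) (c₀ : ℝ≥0)
    (t : ℕ) (x : State d) (u : U) : Measure (State d) :=
  (dirichletProcess (c₀ + t) x.2).bind fun p => (p : Measure ℝ).map (stateUpdate f c₀ t x u)

/-- Control policies: sequences of universally measurable functions from states to actions. -/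
def Policy (d : ℕ) (U : Set (EuclideanSpace ℝ (Fin k))) : Type :=
  {φ : ℕ → State d → U // ∀ t, UniversallyMeasurable (φ t)}

/-- The law of the `n` states after time `t`, started from the state `x` at time `t`, under the
policy `φ`: the measure
`∏_{s = t+1}^{t+n} Q(dx_s | s-1, x_{s-1}, φ_{s-1}(x_{s-1}))` with `x_t = x`. -/
def futureLaw (f : EuclideanSpace ℝ (Fin d) → U → ℝ → EuclideanSpace ℝ (Fin d)) (c₀ : ℝ≥0)
    (φ : Policy d U) : ℕ → (n : ℕ) → State d → Measure (Fin n → State d)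
  | _, 0, _ => Measure.dirac Fin.elim0
  | t, n + 1, x => (transition f c₀ t x (φ.1 t x)).bind fun x' =>
      (futureLaw f c₀ φ (t + 1) n x').map fun ω => (Fin.cons x' ω : Fin (n + 1) → State d)

/-- The law of the whole trajectory `(X_0, …, X_T)` started from `x₀`, on the canonical space. -/
def canonicalLaw (f : EuclideanSpace ℝ (Fin d) → U → ℝ → EuclideanSpace ℝ (Fin d)) (c₀ : ℝ≥0)
    (T : ℕ) (φ : Policy d U) (x₀ : State d) : Measure (Fin (T + 1) → State d) :=
  (Measure.dirac x₀).bind fun x =>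
    (futureLaw f c₀ φ 0 T x).map fun ω => (Fin.cons x ω : Fin (T + 1) → State d)

/-! ### Costs and values -/

/-- The expected terminal loss `E[ℓ(Y_T)]` under the canonical law. -/
def expectedLoss (f : EuclideanSpace ℝ (Fin d) → U → ℝ → EuclideanSpace ℝ (Fin d)) (c₀ : ℝ≥0)
    (T : ℕ) (ℓ : EuclideanSpace ℝ (Fin d) → ℝ) (φ : Policy d U) (x₀ : State d) : EReal :=
  eintegral (canonicalLaw f c₀ T φ x₀) fun ω => (ℓ (ω (Fin.last T)).1 : EReal)

/-- The value `inf_φ E[ℓ(Y_T)]` of the nonparametric adaptive Bayesian control problem. -/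
def problemValue (f : EuclideanSpace ℝ (Fin d) → U → ℝ → EuclideanSpace ℝ (Fin d)) (c₀ : ℝ≥0)
    (T : ℕ) (ℓ : EuclideanSpace ℝ (Fin d) → ℝ) (x₀ : State d) : EReal :=
  ⨅ φ : Policy d U, expectedLoss f c₀ T ℓ φ x₀

/-- The terminal component `Y_{t+n}`, as a function of the states after time `t`; for `n = 0` it
is the component `y` of the current state `x = (y, P)`. -/
def terminalState {n : ℕ} (x : State d) (ω : Fin n → State d) : EuclideanSpace ℝ (Fin d) :=
  ((Fin.cons x ω : Fin (n + 1) → State d) (Fin.last n)).1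

/-- The cost-to-go `V_t(x, φ)` of the policy `φ` from the state `x` at time `t`. -/
def costToGo (f : EuclideanSpace ℝ (Fin d) → U → ℝ → EuclideanSpace ℝ (Fin d)) (c₀ : ℝ≥0)
    (T : ℕ) (ℓ : EuclideanSpace ℝ (Fin d) → ℝ) (t : ℕ) (x : State d) (φ : Policy d U) : EReal :=
  eintegral (futureLaw f c₀ φ t (T - t) x) fun ω => (ℓ (terminalState x ω) : EReal)

/-- The optimal cost-to-go `V*_t(x)`. -/
def optimalCost (f : EuclideanSpace ℝ (Fin d) → U → ℝ → EuclideanSpace ℝ (Fin d)) (c₀ : ℝ≥0)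
    (T : ℕ) (ℓ : EuclideanSpace ℝ (Fin d) → ℝ) (t : ℕ) (x : State d) : EReal :=
  ⨅ φ : Policy d U, costToGo f c₀ T ℓ t x φ

/-- The one-step expectation `E_P[W(G(t, x, u, Z))]`, `x = (y, P)`. -/
def stepExpectation (f : EuclideanSpace ℝ (Fin d) → U → ℝ → EuclideanSpace ℝ (Fin d)) (c₀ : ℝ≥0)
    (t : ℕ) (W : State d → EReal) (x : State d) (u : U) : EReal :=
  eintegral (x.2 : Measure ℝ) fun z => W (stateUpdate f c₀ t x u z)

/-- The Bellman recursion with `n` steps to go at time `t`. -/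
def bellmanIterate (f : EuclideanSpace ℝ (Fin d) → U → ℝ → EuclideanSpace ℝ (Fin d)) (c₀ : ℝ≥0)
    (ℓ : EuclideanSpace ℝ (Fin d) → ℝ) : ℕ → ℕ → State d → EReal
  | _, 0, x => (ℓ x.1 : EReal)
  | t, n + 1, x => ⨅ u : U, stepExpectation f c₀ t (bellmanIterate f c₀ ℓ (t + 1) n) x u

/-- The solution `W_t` of the Bellman equations with horizon `T`, for `t ≤ T`. -/
def bellmanValue (f : EuclideanSpace ℝ (Fin d) → U → ℝ → EuclideanSpace ℝ (Fin d)) (c₀ : ℝ≥0)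
    (T : ℕ) (ℓ : EuclideanSpace ℝ (Fin d) → ℝ) (t : ℕ) : State d → EReal :=
  bellmanIterate f c₀ ℓ t (T - t)

theorem bellmanValue_terminal
    (f : EuclideanSpace ℝ (Fin d) → U → ℝ → EuclideanSpace ℝ (Fin d)) (c₀ : ℝ≥0)
    (T : ℕ) (ℓ : EuclideanSpace ℝ (Fin d) → ℝ) (x : State d) :
    bellmanValue f c₀ T ℓ T x = (ℓ x.1 : EReal) := by
  simp [bellmanValue, bellmanIterate]

theorem bellmanValue_of_lt
    (f : EuclideanSpace ℝ (Fin d) → U → ℝ → EuclideanSpace ℝ (Fin d)) (c₀ : ℝ≥0)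
    (T : ℕ) (ℓ : EuclideanSpace ℝ (Fin d) → ℝ) {t : ℕ} (ht : t < T) (x : State d) :
    bellmanValue f c₀ T ℓ t x
      = ⨅ u : U, stepExpectation f c₀ t (bellmanValue f c₀ T ℓ (t + 1)) x u := by
  obtain ⟨n, rfl⟩ := Nat.exists_eq_add_of_lt ht
  have h1 : t + n + 1 - t = n + 1 := by omega
  have h2 : t + n + 1 - (t + 1) = n := by omega
  simp [bellmanValue, h1, h2, bellmanIterate]

/-- `φ` selects minimizers in the Bellman equations at all times `t < T` and all states. -/
def IsBellmanSelector (f : EuclideanSpace ℝ (Fin d) → U → ℝ → EuclideanSpace ℝ (Fin d))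
    (c₀ : ℝ≥0) (T : ℕ) (ℓ : EuclideanSpace ℝ (Fin d) → ℝ) (φ : Policy d U) : Prop :=
  ∀ t < T, ∀ x : State d,
    stepExpectation f c₀ t (bellmanValue f c₀ T ℓ (t + 1)) x (φ.1 t x)
      = bellmanValue f c₀ T ℓ t x

/-- The expected losses from the state `x` at time `t` are well defined: either the positive part
of the terminal loss has a finite expectation under every policy, or the negative part has
expectations that are bounded over all policies. (This holds at every `t` and `x` if `ℓ` is bounded
from below or from above.) -/
def WellPosed (f : EuclideanSpace ℝ (Fin d) → U → ℝ → EuclideanSpace ℝ (Fin d)) (c₀ : ℝ≥0)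
    (T : ℕ) (ℓ : EuclideanSpace ℝ (Fin d) → ℝ) (t : ℕ) (x : State d) : Prop :=
  (∀ φ : Policy d U,
      ∫⁻ ω, ENNReal.ofReal (ℓ (terminalState x ω)) ∂(futureLaw f c₀ φ t (T - t) x) < ⊤) ∨
    (⨆ φ : Policy d U,
      ∫⁻ ω, ENNReal.ofReal (-ℓ (terminalState x ω)) ∂(futureLaw f c₀ φ t (T - t) x)) < ⊤

end BayesControl

end

namespace BayesControl

open Set Filter Topology

/-! ### The extended-real integral -/

/-- The extended-real difference `a - b` with the convention `∞ - b = ∞`. -/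
noncomputable def extSub (a b : ℝ≥0∞) : EReal := if a = ⊤ then ⊤ else (a : EReal) - (b : EReal)

theorem extSub_top (b : ℝ≥0∞) : extSub ⊤ b = ⊤ := by simp [extSub]

theorem extSub_of_ne_top {a : ℝ≥0∞} (ha : a ≠ ⊤) (b : ℝ≥0∞) : extSub a b = (a : EReal) - b := by
  simp [extSub, ha]

theorem extSub_mono {a a' b b' : ℝ≥0∞} (ha : a ≤ a') (hb : b' ≤ b) :
    extSub a b ≤ extSub a' b' := by
  by_cases h' : a' = ⊤
  · simp [h', extSub_top]
  · have h : a ≠ ⊤ := ne_top_of_le_ne_top h' ha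
    rw [extSub_of_ne_top h, extSub_of_ne_top h']
    exact EReal.sub_le_sub (by exact_mod_cast ha) (by exact_mod_cast hb)

theorem measurable_extSub : Measurable fun p : ℝ≥0∞ × ℝ≥0∞ => extSub p.1 p.2 := by
  unfold extSub
  refine Measurable.ite (measurable_fst (measurableSet_singleton _)) measurable_const ?_
  exact (measurable_fst.coe_ereal_ennreal).sub (measurable_snd.coe_ereal_ennreal)

/-- The hypothesis excludes `a = b = ⊤`, where `extSub` is `⊤` but truncated subtraction gives `0`.
The negative part below needs no such exclusion, since both sides vanish when `a = ⊤`. -/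
theorem toENNReal_extSub {a b : ℝ≥0∞} (h : a ≠ ⊤ ∨ b ≠ ⊤) : (extSub a b).toENNReal = a - b := by
  by_cases ha : a = ⊤
  · subst ha
    have hb : b ≠ ⊤ := by simpa using h
    simp [extSub_top, ENNReal.top_sub hb]
  · rw [extSub_of_ne_top ha, EReal.toENNReal_sub (EReal.coe_ennreal_nonneg _)]
    simp

theorem toENNReal_neg_extSub {a b : ℝ≥0∞} : (-extSub a b).toENNReal = b - a := by
  by_cases ha : a = ⊤
  · subst ha
    simp [extSub_top]
  · rw [extSub_of_ne_top ha, EReal.neg_sub, add_comm, ← sub_eq_add_neg,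
      EReal.toENNReal_sub (EReal.coe_ennreal_nonneg _)]
    · simp
    · exact Or.inl (EReal.coe_ennreal_ne_bot _)
    · exact Or.inl (by simpa using ha)

theorem extSub_lt_top {a b : ℝ≥0∞} : extSub a b < ⊤ ↔ a < ⊤ := by
  by_cases ha : a = ⊤
  · simp [ha, extSub_top]
  · simp only [extSub_of_ne_top ha, lt_top_iff_ne_top, ne_eq, ha, not_false_eq_true, iff_true]
    lift a to ℝ≥0 using ha
    intro h
    rw [sub_eq_add_neg] at h
    have := EReal.add_ne_top (x := ((a : ℝ≥0∞) : EReal)) (y := -(b : EReal)) (by simp) (by simp)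
    exact this h

/-- Cancelling a common part from `a` and `b` does not change their difference. The identity is
stated additively so that it makes sense for infinite values. -/
theorem extSub_eq_extSub {a b p n : ℝ≥0∞} (h : a ≠ ⊤ ∨ b ≠ ⊤) (hp : p ≤ a) (hn : n ≤ b)
    (he : p + b = n + a) : extSub p n = extSub a b := by
  by_cases ha : a = ⊤
  · subst ha
    have hb : b ≠ ⊤ := by simpa using h
    have hp' : p = ⊤ := by
      by_contra hp'
      have : p + b ≠ ⊤ := ENNReal.add_ne_top.2 ⟨hp', hb⟩
      simp [he] at this
    rw [hp', extSub_top, extSub_top]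
  · have hp' : p ≠ ⊤ := ne_top_of_le_ne_top ha hp
    rw [extSub_of_ne_top ha, extSub_of_ne_top hp']
    by_cases hb : b = ⊤
    · subst hb
      have hn' : n = ⊤ := by
        by_contra hn'
        have : n + a ≠ ⊤ := ENNReal.add_ne_top.2 ⟨hn', ha⟩
        simp [← he] at this
      subst hn'
      lift a to ℝ≥0 using ha
      lift p to ℝ≥0 using hp'
      simp only [EReal.coe_ennreal_top, sub_eq_add_neg, EReal.neg_top, EReal.add_bot]
    · have hn' : n ≠ ⊤ := ne_top_of_le_ne_top hb hn
      lift a to ℝ≥0 using ha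
      lift b to ℝ≥0 using hb
      lift p to ℝ≥0 using hp'
      lift n to ℝ≥0 using hn'
      have he' : p + b = n + a := by exact_mod_cast he
      have he2 : (p : ℝ) + b = n + a := by exact_mod_cast he'
      change ((p : ℝ) : EReal) - ((n : ℝ) : EReal) = ((a : ℝ) : EReal) - ((b : ℝ) : EReal)
      rw [← EReal.coe_sub, ← EReal.coe_sub]
      congr 1
      linarith

theorem extSub_toENNReal (x : EReal) : extSub x.toENNReal (-x).toENNReal = x := by
  induction x with
  | bot => simp [extSub]
  | top => simp [extSub]
  | coe x =>
    rw [extSub_of_ne_top (by simp), ← EReal.coe_neg, EReal.real_coe_toENNReal,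
      EReal.real_coe_toENNReal]
    simp only [EReal.coe_ennreal_ofReal]
    rw [← EReal.coe_sub]
    congr 1
    rcases le_total 0 x with h | h <;> simp [h]

variable {α β : Type*} [MeasurableSpace α] [MeasurableSpace β]

theorem eintegral_eq_extSub (μ : Measure α) (f : α → EReal) :
    eintegral μ f = extSub (∫⁻ a, (f a).toENNReal ∂μ) (∫⁻ a, (-(f a)).toENNReal ∂μ) := rfl

theorem eintegral_mono_ae {μ : Measure α} {f g : α → EReal} (h : ∀ᵐ x ∂μ, f x ≤ g x) :
    eintegral μ f ≤ eintegral μ g := by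
  refine extSub_mono (lintegral_mono_ae ?_) (lintegral_mono_ae ?_)
  · filter_upwards [h] with x hx using EReal.toENNReal_le_toENNReal hx
  · filter_upwards [h] with x hx using EReal.toENNReal_le_toENNReal (EReal.neg_le_neg_iff.2 hx)

theorem eintegral_congr_ae {μ : Measure α} {f g : α → EReal} (h : ∀ᵐ x ∂μ, f x = g x) :
    eintegral μ f = eintegral μ g :=
  le_antisymm (eintegral_mono_ae (h.mono fun _ hx => hx.le))
    (eintegral_mono_ae (h.mono fun _ hx => hx.ge))

theorem eintegral_map {μ : Measure α} {s : α → β} {f : β → EReal} (hs : AEMeasurable s μ)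
    (hf : AEMeasurable f (μ.map s)) : eintegral (μ.map s) f = eintegral μ fun x => f (s x) := by
  rw [eintegral_eq_extSub, eintegral_eq_extSub, lintegral_map' hf.ereal_toENNReal hs,
    lintegral_map' (f := fun x => (-f x).toENNReal) hf.neg.ereal_toENNReal hs]

theorem eintegral_dirac [MeasurableSingletonClass α] (x : α) (f : α → EReal) :
    eintegral (Measure.dirac x) f = f x := by
  rw [eintegral_eq_extSub, lintegral_dirac, lintegral_dirac, extSub_toENNReal]

theorem lintegral_lt_top_of_eintegral_lt_top {μ : Measure α} {f : α → EReal}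
    (h : eintegral μ f < ⊤) : ∫⁻ a, (f a).toENNReal ∂μ < ⊤ :=
  extSub_lt_top.1 h

/-- Here `a` and `b` may overlap, so they need not be the positive and negative parts of their
difference. Those parts are `a - b` and `b - a`, and `(a - b) + b = max a b = (b - a) + a` lets the
overlap cancel after integration. -/
theorem eintegral_extSub {μ : Measure α} {a b : α → ℝ≥0∞} (ha : AEMeasurable a μ)
    (hb : AEMeasurable b μ) (h : ∫⁻ x, a x ∂μ < ⊤ ∨ ∫⁻ x, b x ∂μ < ⊤) :
    eintegral μ (fun x => extSub (a x) (b x)) = extSub (∫⁻ x, a x ∂μ) (∫⁻ x, b x ∂μ) := by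
  have hfin : ∀ᵐ x ∂μ, a x ≠ ⊤ ∨ b x ≠ ⊤ := by
    rcases h with h | h
    · filter_upwards [ae_lt_top' ha h.ne] with x hx using Or.inl hx.ne
    · filter_upwards [ae_lt_top' hb h.ne] with x hx using Or.inr hx.ne
  have h1 : ∫⁻ x, (extSub (a x) (b x)).toENNReal ∂μ = ∫⁻ x, a x - b x ∂μ :=
    lintegral_congr_ae (hfin.mono fun x hx => toENNReal_extSub hx)
  have h2 : ∫⁻ x, (-extSub (a x) (b x)).toENNReal ∂μ = ∫⁻ x, b x - a x ∂μ :=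
    lintegral_congr fun x => toENNReal_neg_extSub
  rw [eintegral_eq_extSub, h1, h2]
  refine extSub_eq_extSub (h.imp (fun h => h.ne) fun h => h.ne)
    (lintegral_mono fun x => tsub_le_self) (lintegral_mono fun x => tsub_le_self) ?_
  rw [← lintegral_add_right' _ hb, ← lintegral_add_right' _ ha]
  refine lintegral_congr fun x => ?_
  rw [tsub_add_eq_max, tsub_add_eq_max, max_comm]

/-- Fubini's theorem for the extended-real integral. -/
theorem eintegral_bind {μ : Measure α} {κ : α → Measure β} {f : β → EReal} (hκ : AEMeasurable κ μ)
    (hf : AEMeasurable f (μ.bind κ))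
    (h : ∫⁻ y, (f y).toENNReal ∂(μ.bind κ) < ⊤ ∨ ∫⁻ y, (-(f y)).toENNReal ∂(μ.bind κ) < ⊤) :
    eintegral (μ.bind κ) f = eintegral μ fun x => eintegral (κ x) f := by
  have h1 := Measure.lintegral_bind hκ hf.ereal_toENNReal
  have h2 := Measure.lintegral_bind hκ hf.neg.ereal_toENNReal
  have m1 : AEMeasurable (fun x => ∫⁻ y, (f y).toENNReal ∂κ x) μ :=
    (Measure.aemeasurable_lintegral hf.ereal_toENNReal).comp_aemeasurable hκ
  have m2 : AEMeasurable (fun x => ∫⁻ y, (-f y).toENNReal ∂κ x) μ :=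
    (Measure.aemeasurable_lintegral hf.neg.ereal_toENNReal).comp_aemeasurable hκ
  simp only [Pi.neg_apply] at h2
  rw [h1, h2] at h
  rw [eintegral_eq_extSub, h1, h2, ← eintegral_extSub m1 m2 h]
  rfl

theorem measurable_eintegral {f : α → EReal} (hf : Measurable f) :
    Measurable fun μ : Measure α => eintegral μ f :=
  measurable_extSub.comp
    ((Measure.measurable_lintegral hf.ereal_toENNReal).prodMk
      (Measure.measurable_lintegral hf.neg.ereal_toENNReal))

/-- A strict upper approximation of `x`, decreasing to `x` as `n → ∞`. -/
noncomputable def upperApprox (n : ℕ) (x : EReal) : ℝ :=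
  -- The shift makes the majorant strict; the floor `-n` keeps it real when `x = ⊥`.
  (max (x + ((1 / (n + 1 : ℝ) : ℝ) : EReal)) (-n : ℝ)).toReal

theorem coe_upperApprox (n : ℕ) {x : EReal} (hx : x ≠ ⊤) :
    ((upperApprox n x : ℝ) : EReal) = max (x + ((1 / (n + 1 : ℝ) : ℝ) : EReal)) (-n : ℝ) := by
  rw [upperApprox, EReal.coe_toReal]
  · exact (max_lt (EReal.add_lt_top hx (EReal.coe_ne_top _)) (EReal.coe_lt_top _)).ne
  · exact (lt_of_lt_of_le (EReal.bot_lt_coe _) (le_max_right _ _)).ne'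

theorem measurable_upperApprox (n : ℕ) : Measurable (upperApprox n) :=
  ((measurable_id.add measurable_const).max measurable_const).ereal_toReal

theorem lt_upperApprox (n : ℕ) {x : EReal} (hx : x ≠ ⊤) : x < (upperApprox n x : EReal) := by
  rw [coe_upperApprox n hx]
  induction x with
  | top => exact absurd rfl hx
  | bot => exact lt_max_of_lt_right (EReal.bot_lt_coe _)
  | coe x =>
    refine lt_max_of_lt_left ?_
    rw [← EReal.coe_add, EReal.coe_lt_coe_iff]
    have : (0 : ℝ) < 1 / (n + 1) := by positivity
    linarith

theorem toENNReal_upperApprox_le (n : ℕ) {x : EReal} (hx : x ≠ ⊤) :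
    ((upperApprox n x : ℝ) : EReal).toENNReal ≤ x.toENNReal + ENNReal.ofReal (1 / (n + 1)) := by
  rw [coe_upperApprox n hx]
  induction x with
  | top => exact absurd rfl hx
  | bot => simp
  | coe x =>
    rw [← EReal.coe_add, ← EReal.coe_strictMono.monotone.map_max, EReal.real_coe_toENNReal,
      EReal.real_coe_toENNReal]
    refine le_trans ?_ ENNReal.ofReal_add_le
    rcases le_total (x + 1 / (n + 1)) (-(n : ℝ)) with h | h
    · rw [max_eq_right h, ENNReal.ofReal_of_nonpos (by simp)]; exact bot_le
    · rw [max_eq_left h]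

theorem le_toENNReal_neg_upperApprox (n : ℕ) {x : EReal} (hx : x ≠ ⊤) :
    min ((-x).toENNReal - ENNReal.ofReal (1 / (n + 1))) n
      ≤ (-((upperApprox n x : ℝ) : EReal)).toENNReal := by
  rw [coe_upperApprox n hx]
  induction x with
  | top => exact absurd rfl hx
  | bot =>
    rw [EReal.bot_add, max_eq_right bot_le, ← EReal.coe_neg, EReal.real_coe_toENNReal]
    simp
  | coe x =>
    rw [← EReal.coe_add, ← EReal.coe_strictMono.monotone.map_max, ← EReal.coe_neg, ← EReal.coe_neg,
      EReal.real_coe_toENNReal, EReal.real_coe_toENNReal,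
      ← ENNReal.ofReal_sub _ (by positivity)]
    rcases le_total (x + 1 / (n + 1)) (-(n : ℝ)) with h | h
    · rw [max_eq_right h]; simp
    · rw [max_eq_left h]
      refine (min_le_left _ _).trans (ENNReal.ofReal_le_ofReal (by linarith))

theorem iSup_min_sub (y : ℝ≥0∞) :
    ⨆ n : ℕ, min (y - ENNReal.ofReal (1 / (n + 1))) n = y := by
  refine le_antisymm (iSup_le fun n => (min_le_left _ _).trans tsub_le_self) ?_
  have hlim : Tendsto (fun n : ℕ => min (y - ENNReal.ofReal (1 / (n + 1))) n) atTop
      (𝓝 (min (y - ENNReal.ofReal 0) ⊤)) := by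
    refine Tendsto.min ?_ ENNReal.tendsto_nat_nhds_top
    refine ENNReal.Tendsto.sub tendsto_const_nhds
      (ENNReal.tendsto_ofReal tendsto_one_div_add_atTop_nhds_zero_nat) (Or.inr (by simp))
  simp only [ENNReal.ofReal_zero, tsub_zero, min_top_right] at hlim
  exact le_of_tendsto' hlim fun n =>
    le_iSup (fun n : ℕ => min (y - ENNReal.ofReal (1 / (n + 1))) (n : ℝ≥0∞)) n

/-- If the integral of `W` is below `r`, then so is that of some real measurable strict majorant. -/
theorem exists_gt_eintegral_lt {μ : Measure α} [IsProbabilityMeasure μ] {W : α → EReal}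
    (hW : AEMeasurable W μ) {r : EReal} (h : eintegral μ W < r) :
    ∃ g : α → ℝ, Measurable g ∧ (∀ᵐ x ∂μ, W x < g x) ∧
      eintegral μ (fun x => (g x : EReal)) < r := by
  obtain ⟨W', hW', hae⟩ := hW
  rw [eintegral_congr_ae hae] at h
  have hpos := lintegral_lt_top_of_eintegral_lt_top (h.trans_le le_top)
  have hfin : ∀ᵐ x ∂μ, W' x ≠ ⊤ := by
    filter_upwards [ae_lt_top hW'.ereal_toENNReal hpos.ne] with x hx
    simpa using hx.ne
  set A := ∫⁻ x, (W' x).toENNReal ∂μ with hA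
  set B := ∫⁻ x, (-(W' x)).toENNReal ∂μ with hB
  -- A lower bound for the negative part of the `n`-th approximation. It increases to the negative
  -- part of `W'`, so monotone convergence applies even if the limit integral is infinite.
  set g : ℕ → α → ℝ≥0∞ := fun n x => min ((-(W' x)).toENNReal - ENNReal.ofReal (1 / (n + 1))) n
    with hg
  have hgm : ∀ n, Measurable (g n) := fun n =>
    (hW'.neg.ereal_toENNReal.sub measurable_const).min measurable_const
  have hgmono : Monotone g := by
    intro m n hmn x
    refine min_le_min (tsub_le_tsub_left (ENNReal.ofReal_le_ofReal ?_) _) (by exact_mod_cast hmn)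
    exact Nat.one_div_le_one_div hmn
  have hB' : Tendsto (fun n => ∫⁻ x, g n x ∂μ) atTop (𝓝 B) := by
    have : B = ⨆ n, ∫⁻ x, g n x ∂μ := by
      rw [← lintegral_iSup hgm hgmono, hB]
      exact lintegral_congr fun x => (iSup_min_sub _).symm
    rw [this]
    exact tendsto_atTop_iSup fun m n hmn => lintegral_mono (hgmono hmn)
  have hA' : Tendsto (fun n : ℕ => A + ENNReal.ofReal (1 / (n + 1))) atTop
      (𝓝 (A + ENNReal.ofReal 0)) :=
    tendsto_const_nhds.add (ENNReal.tendsto_ofReal tendsto_one_div_add_atTop_nhds_zero_nat)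
  rw [ENNReal.ofReal_zero, add_zero] at hA'
  have hlim : Tendsto (fun n : ℕ => extSub (A + ENNReal.ofReal (1 / (n + 1))) (∫⁻ x, g n x ∂μ))
      atTop (𝓝 (extSub A B)) := by
    have : ∀ n : ℕ, extSub (A + ENNReal.ofReal (1 / (n + 1))) (∫⁻ x, g n x ∂μ)
        = ((A + ENNReal.ofReal (1 / (n + 1)) : ℝ≥0∞) : EReal) +
          -((∫⁻ x, g n x ∂μ : ℝ≥0∞) : EReal) :=
      fun n => extSub_of_ne_top (ENNReal.add_ne_top.2 ⟨hpos.ne, by simp⟩) _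
    simp_rw [this]
    rw [extSub_of_ne_top hpos.ne, sub_eq_add_neg]
    -- Addition on `EReal` is discontinuous only at opposite infinities, excluded here because `A`
    -- is finite.
    have c := EReal.continuousAt_add (p := ((A : EReal), -(B : EReal)))
      (Or.inl (by simpa using hpos.ne))
      (Or.inl (by simp))
    refine c.tendsto.comp (Tendsto.prodMk_nhds ?_ ?_)
    · exact (continuous_coe_ennreal_ereal.tendsto _).comp hA'
    · exact (continuous_neg.tendsto _).comp ((continuous_coe_ennreal_ereal.tendsto _).comp hB')
  obtain ⟨n, hn⟩ := (hlim.eventually (Iio_mem_nhds h)).exists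
  refine ⟨fun x => upperApprox n (W' x), (measurable_upperApprox n).comp hW', ?_, ?_⟩
  · filter_upwards [hae, hfin] with x hx hx'
    rw [hx]; exact lt_upperApprox n hx'
  · refine lt_of_le_of_lt (extSub_mono ?_ ?_) hn
    · calc ∫⁻ x, ((upperApprox n (W' x) : ℝ) : EReal).toENNReal ∂μ
          ≤ ∫⁻ x, ((W' x).toENNReal + ENNReal.ofReal (1 / (n + 1))) ∂μ :=
            lintegral_mono_ae (hfin.mono fun x hx => toENNReal_upperApprox_le n hx)
        _ = A + ENNReal.ofReal (1 / (n + 1)) := by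
            rw [lintegral_add_right _ measurable_const]; simp [hA]
    · exact lintegral_mono_ae (hfin.mono fun x hx => le_toENNReal_neg_upperApprox n hx)

/-! ### Universally measurable functions -/

section UniversallyMeasurable

variable {α β γ : Type*} [MeasurableSpace α] [MeasurableSpace β] [MeasurableSpace γ]

theorem _root_.Measurable.universallyMeasurable {f : α → β} (hf : Measurable f) :
    UniversallyMeasurable f :=
  fun _ _ => hf.nullMeasurable

theorem UniversallyMeasurable.aemeasurable [MeasurableSpace.CountablyGenerated β] {f : α → β}
    (hf : UniversallyMeasurable f) (μ : Measure α) [IsProbabilityMeasure μ] : AEMeasurable f μ :=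
  (hf μ inferInstance).aemeasurable

/-- Testing `g ∘ f` against `μ` amounts to testing `g` against `μ.map f`. This is why all
probability measures must be allowed in the definition. -/
theorem UniversallyMeasurable.comp [MeasurableSpace.CountablyGenerated β]
    [MeasurableSpace.CountablyGenerated γ] {g : β → γ} {f : α → β}
    (hg : UniversallyMeasurable g) (hf : UniversallyMeasurable f) :
    UniversallyMeasurable fun x => g (f x) := by
  intro μ hμ
  have h := hf.aemeasurable μ
  have : IsProbabilityMeasure (μ.map f) := Measure.isProbabilityMeasure_map h
  exact ((hg.aemeasurable (μ.map f)).comp_aemeasurable h).nullMeasurable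

theorem UniversallyMeasurable.prodMk [MeasurableSpace.CountablyGenerated β]
    [MeasurableSpace.CountablyGenerated γ] {f : α → β} {g : α → γ}
    (hf : UniversallyMeasurable f) (hg : UniversallyMeasurable g) :
    UniversallyMeasurable fun x => (f x, g x) :=
  fun μ _ => ((hf.aemeasurable μ).prodMk (hg.aemeasurable μ)).nullMeasurable

end UniversallyMeasurable

/-! ### Sets of sequences with a given initial segment -/

/-- The sequences whose initial segment, in reverse order, is the list `l`. -/
def initialSet (l : List ℕ) : Set (ℕ → ℕ) := {σ | PiNat.res σ l.length = l}

theorem initialSet_eq_iUnion (l : List ℕ) : initialSet l = ⋃ k, initialSet (k :: l) := by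
  ext σ
  simp [initialSet, PiNat.res_succ]

theorem isOpen_initialSet (l : List ℕ) : IsOpen (initialSet l) := by
  rcases (initialSet l).eq_empty_or_nonempty with h | ⟨σ, hσ⟩
  · simp [h]
  · have : initialSet l = PiNat.cylinder σ l.length := by
      rw [PiNat.cylinder_eq_res]
      ext τ
      have hσ' : PiNat.res σ l.length = l := hσ
      simp [initialSet, hσ']
    rw [this]
    exact PiNat.isOpen_cylinder (E := fun _ => ℕ) σ _

theorem exists_initialSet_subset {σ : ℕ → ℕ} {s : Set (ℕ → ℕ)} (hs : s ∈ 𝓝 σ) :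
    ∃ n, initialSet (PiNat.res σ n) ⊆ s := by
  obtain ⟨t, ⟨x, n, rfl⟩, hx, ht⟩ :=
    (PiNat.isTopologicalBasis_cylinders (fun _ => ℕ)).mem_nhds_iff.1 hs
  refine ⟨n, fun τ hτ => ht ?_⟩
  rw [PiNat.cylinder_eq_res] at hx ⊢
  have hx' : PiNat.res σ n = PiNat.res x n := hx
  simpa [initialSet, ← hx'] using hτ

/-- A sequence through a tree without dead ends. -/
theorem exists_branch (P : List ℕ → Prop) (h0 : P []) (hs : ∀ l, P l → ∃ k, P (k :: l)) :
    ∃ σ : ℕ → ℕ, ∀ n, P (PiNat.res σ n) := by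
  choose! f hf using hs
  let L : ℕ → List ℕ := fun n => Nat.rec [] (fun _ l => f l :: l) n
  have hres : ∀ n, PiNat.res (fun n => f (L n)) n = L n := by
    intro n
    induction n with
    | zero => rfl
    | succ n ih => rw [PiNat.res_succ, ih]
  refine ⟨fun n => f (L n), fun n => ?_⟩
  rw [hres]
  induction n with
  | zero => exact h0
  | succ n ih => exact hf _ ih

theorem eq_of_forall_mem_closure {X : Type*} [TopologicalSpace X] [T3Space X] {g : (ℕ → ℕ) → X}
    (hg : Continuous g) {σ : ℕ → ℕ} {x : X}
    (hx : ∀ n, x ∈ closure (g '' initialSet (PiNat.res σ n))) : g σ = x := by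
  by_contra hne
  obtain ⟨s, ⟨hs, hsc⟩, hxs⟩ : ∃ s, (s ∈ 𝓝 (g σ) ∧ IsClosed s) ∧ s ⊆ {x}ᶜ :=
    (closed_nhds_basis (g σ)).mem_iff.1 (isOpen_compl_singleton.mem_nhds hne)
  obtain ⟨n, hn⟩ := exists_initialSet_subset (hg.continuousAt hs)
  have : closure (g '' initialSet (PiNat.res σ n)) ⊆ s :=
    closure_minimal (image_subset_iff.2 hn) hsc
  exact hxs (this (hx n)) rfl

/-- Continuous images of the Baire space are measurable for the completion of every finite
measure. -/
theorem nullMeasurableSet_range_of_continuous {X : Type*} [TopologicalSpace X] [T3Space X]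
    [MeasurableSpace X] [BorelSpace X] {g : (ℕ → ℕ) → X} (hg : Continuous g) (μ : Measure X)
    [IsFiniteMeasure μ] : NullMeasurableSet (range g) μ := by
  let A : List ℕ → Set X := fun l => g '' initialSet l
  -- The measurable hull makes the loss at each node null, while the closure forces a point lying in
  -- all sets along a branch to be the image of that branch.
  let H : List ℕ → Set X := fun l => toMeasurable μ (A l) ∩ closure (A l)
  have hA : ∀ l, A l ⊆ H l := fun l => subset_inter (subset_toMeasurable _ _) subset_closure
  have hH : ∀ l, MeasurableSet (H l) := fun l =>
    (measurableSet_toMeasurable _ _).inter isClosed_closure.measurableSet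
  have hAU : ∀ l, A l ⊆ ⋃ k, H (k :: l) := by
    intro l
    simp only [A]
    rw [initialSet_eq_iUnion, image_iUnion]
    exact iUnion_mono fun k => hA (k :: l)
  have hnull : ∀ l, μ (H l \ ⋃ k, H (k :: l)) = 0 := by
    intro l
    have hC : MeasurableSet (⋃ k, H (k :: l))ᶜ := (MeasurableSet.iUnion fun k => hH _).compl
    refine measure_mono_null (t := toMeasurable μ (A l) ∩ (⋃ k, H (k :: l))ᶜ)
      (fun x hx => ⟨hx.1.1, hx.2⟩) ?_
    rw [Measure.measure_toMeasurable_inter hC (measure_ne_top _ _)]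
    have : A l ∩ (⋃ k, H (k :: l))ᶜ = ∅ := by
      rw [← sdiff_eq, sdiff_eq_empty.2 (hAU l)]
    rw [this, measure_empty]
  have hN : μ (⋃ l, H l \ ⋃ k, H (k :: l)) = 0 := measure_iUnion_null hnull
  have hroot : A [] = range g := by simp [A, initialSet]
  refine (hH []).nullMeasurableSet.congr ?_
  refine EventuallyLE.antisymm ?_ (Eventually.of_forall fun x hx => hA [] (hroot.symm ▸ hx))
  have hae : ∀ᵐ x ∂μ, x ∉ ⋃ l, H l \ ⋃ k, H (k :: l) := measure_eq_zero_iff_ae_notMem.1 hN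
  filter_upwards [hae] with x hx hx0
  -- Outside the countable union of null sets, every hull containing `x` has a child containing `x`,
  -- so the tree of such nodes has no dead ends.
  obtain ⟨σ, hσ⟩ := exists_branch (fun l => x ∈ H l) hx0 (by
    intro l hl
    by_contra hcon
    exact hx (mem_iUnion.2 ⟨l, hl, fun hU => hcon (mem_iUnion.1 hU)⟩))
  exact ⟨σ, eq_of_forall_mem_closure hg fun n => (hσ n).2⟩

/-! ### Analytic sets in standard Borel spaces -/

section Souslin

variable {α β : Type*} [MeasurableSpace α] [MeasurableSpace β]

/-- Projections to `α` of measurable subsets of `α × ℝ`; if `α` is standard Borel, these are the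
analytic sets. -/
def Souslin (A : Set α) : Prop := ∃ B : Set (α × ℝ), MeasurableSet B ∧ A = Prod.fst '' B

theorem _root_.MeasurableSet.souslin {A : Set α} (hA : MeasurableSet A) : Souslin A := by
  refine ⟨Prod.fst ⁻¹' A, measurable_fst hA, ?_⟩
  ext x
  simp

theorem Souslin.preimage {A : Set β} (hA : Souslin A) {f : α → β} (hf : Measurable f) :
    Souslin (f ⁻¹' A) := by
  obtain ⟨B, hB, rfl⟩ := hA
  refine ⟨(fun p : α × ℝ => (f p.1, p.2)) ⁻¹' B,
    ((hf.comp measurable_fst).prodMk measurable_snd) hB, ?_⟩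
  ext x
  simp

theorem Souslin.inter_measurable {A C : Set α} (hA : Souslin A) (hC : MeasurableSet C) :
    Souslin (A ∩ C) := by
  obtain ⟨B, hB, rfl⟩ := hA
  refine ⟨B ∩ Prod.fst ⁻¹' C, hB.inter (measurable_fst hC), ?_⟩
  ext x
  simp

theorem Souslin.iUnion {ι : Type*} [Countable ι] {A : ι → Set α} (hA : ∀ i, Souslin (A i)) :
    Souslin (⋃ i, A i) := by
  choose B hB hAB using hA
  refine ⟨⋃ i, B i, MeasurableSet.iUnion hB, ?_⟩
  simp_rw [hAB, image_iUnion]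

/-- The eliminated coordinate and the old witness are coded together by one real number. A Borel
embedding into `ℝ` keeps the image of a measurable set measurable. -/
theorem Souslin.fst_image [StandardBorelSpace β] {A : Set (α × β)} (hA : Souslin A) :
    Souslin (Prod.fst '' A) := by
  obtain ⟨B, hB, rfl⟩ := hA
  have he := measurableEmbedding_embeddingReal (β × ℝ)
  have hid : MeasurableEmbedding (Prod.map (id : α → α) (embeddingReal (β × ℝ))) :=
    MeasurableEmbedding.id.prodMap he
  refine ⟨Prod.map (id : α → α) (embeddingReal (β × ℝ)) '' (MeasurableEquiv.prodAssoc '' B),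
    hid.measurableSet_image.2 (MeasurableEquiv.prodAssoc.measurableSet_image.2 hB), ?_⟩
  ext x
  simp [MeasurableEquiv.prodAssoc]

theorem Souslin.union {A C : Set α} (hA : Souslin A) (hC : Souslin C) : Souslin (A ∪ C) := by
  rw [union_eq_iUnion]
  exact Souslin.iUnion fun b => by cases b <;> assumption

/-- The separate witnesses are collected into one point of the standard Borel space `ι → ℝ`. -/
theorem Souslin.iInter {ι : Type*} [Countable ι] {A : ι → Set α} (hA : ∀ i, Souslin (A i)) :
    Souslin (⋂ i, A i) := by
  choose B hB hAB using hA
  have h : (⋂ i, A i) = Prod.fst '' (⋂ i, (fun p : α × (ι → ℝ) => (p.1, p.2 i)) ⁻¹' B i) := by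
    ext x
    simp only [mem_iInter, hAB, mem_image, Prod.exists, exists_and_right, exists_eq_right,
      mem_preimage]
    exact ⟨fun h => ⟨fun i => (h i).choose, fun i => (h i).choose_spec⟩,
      fun ⟨f, hf⟩ i => ⟨f i, hf i⟩⟩
  rw [h]
  refine (MeasurableSet.souslin (MeasurableSet.iInter fun i => ?_)).fst_image
  exact (measurable_fst.prodMk ((measurable_pi_apply i).comp measurable_snd)) (hB i)

theorem Souslin.image [StandardBorelSpace α] [MeasurableEq β] {f : α → β} (hf : Measurable f)
    {s : Set α} (hs : MeasurableSet s) : Souslin (f '' s) := by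
  have h : f '' s = Prod.fst '' {p : β × α | p.1 = f p.2 ∧ p.2 ∈ s} := by
    ext y
    constructor
    · rintro ⟨x, hx, rfl⟩
      exact ⟨(f x, x), ⟨rfl, hx⟩, rfl⟩
    · rintro ⟨⟨_, x⟩, ⟨h1, hx⟩, rfl⟩
      exact ⟨x, hx, h1.symm⟩
  rw [h]
  exact (MeasurableSet.souslin ((measurableSet_eq_fun measurable_fst
    (hf.comp measurable_snd)).inter (measurable_snd hs))).fst_image

theorem Souslin.nullMeasurableSet [StandardBorelSpace α] {A : Set α} (hA : Souslin A)
    (μ : Measure α) [IsFiniteMeasure μ] : NullMeasurableSet A μ := by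
  obtain ⟨B, hB, rfl⟩ := hA
  let _ := upgradeStandardBorel α
  have hB' := hB.analyticSet
  rw [AnalyticSet] at hB'
  rcases hB' with rfl | ⟨f, hf, rfl⟩
  · simp
  · rw [← range_comp]
    exact nullMeasurableSet_range_of_continuous (continuous_fst.comp hf) μ

end Souslin

/-! ### Measurable selection -/

open Classical in
/-- The least continuation `k` of `l` such that `x` has a preimage under `g` with initial segment
`k :: l`, if there is one. -/
noncomputable def leastExtension {X : Type*} (g : (ℕ → ℕ) → X) (x : X) (l : List ℕ) : ℕ :=
  -- Stated as an implication, the predicate is always satisfiable; without any valid continuation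
  -- the search returns `0`.
  Nat.find (p := fun k => (∃ j, x ∈ g '' initialSet (j :: l)) → x ∈ g '' initialSet (k :: l))
    (by
      by_cases h : ∃ j, x ∈ g '' initialSet (j :: l)
      · exact ⟨h.choose, fun _ => h.choose_spec⟩
      · exact ⟨0, fun h' => absurd h' h⟩)

theorem mem_leastExtension {X : Type*} {g : (ℕ → ℕ) → X} {x : X} {l : List ℕ}
    (h : x ∈ g '' initialSet l) : x ∈ g '' initialSet (leastExtension g x l :: l) := by
  classical
  rw [initialSet_eq_iUnion, image_iUnion, mem_iUnion] at h
  exact Nat.find_spec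
    (p := fun k => (∃ j, x ∈ g '' initialSet (j :: l)) → x ∈ g '' initialSet (k :: l)) _ h

/-- The initial segments of the lexicographically least preimage of `x` under `g`. -/
noncomputable def leastSegment {X : Type*} (g : (ℕ → ℕ) → X) (x : X) : ℕ → List ℕ
  | 0 => []
  | n + 1 => leastExtension g x (leastSegment g x n) :: leastSegment g x n

/-- The lexicographically least preimage of `x` under `g`, if `x` is in the range of `g`. -/
noncomputable def leastPreimage {X : Type*} (g : (ℕ → ℕ) → X) (x : X) : ℕ → ℕ :=
  fun n => leastExtension g x (leastSegment g x n)

theorem res_leastPreimage {X : Type*} (g : (ℕ → ℕ) → X) (x : X) (n : ℕ) :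
    PiNat.res (leastPreimage g x) n = leastSegment g x n := by
  induction n with
  | zero => rfl
  | succ n ih => rw [PiNat.res_succ, ih]; rfl

theorem apply_leastPreimage {X : Type*} [TopologicalSpace X] [T3Space X] {g : (ℕ → ℕ) → X}
    (hg : Continuous g) {x : X} (hx : x ∈ range g) : g (leastPreimage g x) = x := by
  refine eq_of_forall_mem_closure hg fun n => subset_closure ?_
  rw [res_leastPreimage]
  induction n with
  | zero => simpa [leastSegment, initialSet] using hx
  | succ n ih => exact mem_leastExtension ih

/-- Each digit is decided by countably many analytic sets and their complements, so it is measurable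
for the completed `σ`-algebra. Only countably many lists occur as initial segments, which allows
induction on their length. -/
theorem universallyMeasurable_leastPreimage {X : Type*} [MeasurableSpace X]
    [StandardBorelSpace X] {g : (ℕ → ℕ) → X} (hg : Measurable g) :
    UniversallyMeasurable (leastPreimage g) := by
  classical
  intro μ hμ
  have hA : ∀ l, NullMeasurableSet (g '' initialSet l) μ := fun l =>
    (Souslin.image hg (isOpen_initialSet l).measurableSet).nullMeasurableSet μ
  have hext : ∀ l, Measurable (α := NullMeasurableSpace X μ) (fun x => leastExtension g x l) := by
    intro l
    refine measurable_find (α := NullMeasurableSpace X μ) _ fun k => ?_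
    have : {x : X | (∃ j, x ∈ g '' initialSet (j :: l)) → x ∈ g '' initialSet (k :: l)}
        = (⋃ j, g '' initialSet (j :: l))ᶜ ∪ g '' initialSet (k :: l) := by
      ext x
      simp only [mem_ofPred_eq, mem_union, mem_compl_iff, mem_iUnion, imp_iff_not_or]
    exact this ▸ (NullMeasurableSet.iUnion fun j => hA _).compl.union (hA _)
  have hseg : ∀ n l, NullMeasurableSet {x | leastSegment g x n = l} μ := by
    intro n
    induction n with
    | zero => intro l; exact NullMeasurableSet.const ([] = l)
    | succ n ih =>
      intro l
      have : {x | leastSegment g x (n + 1) = l}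
          = ⋃ l', {x | leastSegment g x n = l'} ∩
            (fun x => leastExtension g x l') ⁻¹' {k | k :: l' = l} := by
        ext x
        simp [leastSegment]
      rw [this]
      exact NullMeasurableSet.iUnion fun l' => (ih l').inter (hext l' trivial)
  have hcoord : ∀ n, Measurable (α := NullMeasurableSpace X μ) (fun x => leastPreimage g x n) := by
    intro n s _
    have : (fun x => leastPreimage g x n) ⁻¹' s
        = ⋃ l', {x | leastSegment g x n = l'} ∩ (fun x => leastExtension g x l') ⁻¹' s := by
      ext x
      simp [leastPreimage]
    have h : NullMeasurableSet ((fun x => leastPreimage g x n) ⁻¹' s) μ := by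
      rw [this]
      exact NullMeasurableSet.iUnion fun l' => (hseg n l').inter (hext l' trivial)
    exact h
  exact fun s hs => (measurable_pi_lambda (α := NullMeasurableSpace X μ) _ hcoord) hs

/-- The Jankov–von Neumann selection theorem. -/
theorem Souslin.exists_universallyMeasurable_selector {X Y : Type*} [MeasurableSpace X]
    [MeasurableSpace Y] [StandardBorelSpace X] [StandardBorelSpace Y] [Nonempty Y]
    {D : Set (X × Y)} (hD : Souslin D) :
    ∃ φ : X → Y, UniversallyMeasurable φ ∧ ∀ x y, (x, y) ∈ D → (x, φ x) ∈ D := by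
  obtain ⟨B, hB, rfl⟩ := hD
  let _ := upgradeStandardBorel X
  let _ := upgradeStandardBorel Y
  have hB' := hB.analyticSet
  rw [AnalyticSet] at hB'
  rcases hB' with rfl | ⟨f, hf, rfl⟩
  · exact ⟨fun _ => Classical.arbitrary Y, measurable_const.universallyMeasurable, by simp⟩
  · have hg : Continuous fun σ => (f σ).1.1 := by fun_prop
    have h2 : Measurable fun σ => (f σ).1.2 := by
      have : Continuous fun σ => (f σ).1.2 := by fun_prop
      exact this.measurable
    -- `f` parametrizes `B` by the Baire space. The selector takes the least parameter lying over
    -- `x` and reads off its `Y`-coordinate.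
    refine ⟨fun x => (f (leastPreimage (fun σ => (f σ).1.1) x)).1.2,
      h2.universallyMeasurable.comp (universallyMeasurable_leastPreimage hg.measurable), ?_⟩
    rintro x y ⟨_, ⟨σ, rfl⟩, hσ⟩
    have hx := apply_leastPreimage hg (x := x) ⟨σ, by simp [hσ]⟩
    exact ⟨f (leastPreimage (fun σ => (f σ).1.1) x), ⟨_, rfl⟩, Prod.ext hx rfl⟩

/-! ### The space of probability measures on the real line is standard Borel -/

section ProbabilityMeasureReal

theorem standardBorelSpace_of_measurableEquiv {α β : Type*} [MeasurableSpace α]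
    [MeasurableSpace β] [StandardBorelSpace β] (e : α ≃ᵐ β) : StandardBorelSpace α := by
  let _ := upgradeStandardBorel β
  let _ : TopologicalSpace α := TopologicalSpace.induced e inferInstance
  have hi : IsInducing e := ⟨rfl⟩
  have hp : PolishSpace α :=
    (e.toEquiv.toHomeomorphOfIsInducing hi).isClosedEmbedding.polishSpace
  have hb : BorelSpace α := e.measurableEmbedding.borelSpace hi
  exact ⟨inferInstance, hb, hp⟩

/-- The values of the distribution function of `p` at the rationals. -/
def ratCDF (p : ProbabilityMeasure ℝ) (q : ℚ) : ℝ := ((p : Measure ℝ) (Iic (q : ℝ))).toReal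

theorem measurable_ratCDF : Measurable ratCDF :=
  measurable_pi_lambda _ fun _ =>
    ((Measure.measurable_coe measurableSet_Iic).comp measurable_subtype_coe).ennreal_toReal

/-- The probability measure with given values of the distribution function at the rationals. -/
noncomputable def ofRatCDF (c : ℚ → ℝ) : ProbabilityMeasure ℝ :=
  ⟨(stieltjesOfMeasurableRat (fun c : ℚ → ℝ => c) measurable_id c).measure, inferInstance⟩

theorem measurable_ofRatCDF : Measurable ofRatCDF :=
  (measurable_measure_stieltjesOfMeasurableRat measurable_id).subtype_mk

theorem ratCDF_eq_cdf (p : ProbabilityMeasure ℝ) (q : ℚ) : ratCDF p q = cdf (p : Measure ℝ) q := by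
  rw [cdf_eq_real]; rfl

theorem isRatStieltjesPoint_ratCDF (p : ProbabilityMeasure ℝ) :
    IsRatStieltjesPoint (fun c : ℚ → ℝ => c) (ratCDF p) where
  mono q r h := by
    simp only [ratCDF_eq_cdf]
    exact monotone_cdf _ (by exact_mod_cast h)
  tendsto_atTop_one := by
    have : ratCDF p = fun q : ℚ => cdf (p : Measure ℝ) q := funext (ratCDF_eq_cdf p)
    rw [this]
    exact (tendsto_cdf_atTop _).comp (tendsto_ratCast_atTop_iff.2 tendsto_id)
  tendsto_atBot_zero := by
    have : ratCDF p = fun q : ℚ => cdf (p : Measure ℝ) q := funext (ratCDF_eq_cdf p)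
    rw [this]
    exact (tendsto_cdf_atBot _).comp (tendsto_ratCast_atBot_iff.2 tendsto_id)
  iInf_rat_gt_eq t := by
    simp only [ratCDF_eq_cdf]
    rw [← StieltjesFunction.iInf_rat_gt_eq]
    refine (Equiv.subtypeEquivRight (p := fun r : ℚ => r ∈ Ioi t)
      (q := fun r : ℚ => (t : ℝ) < r) ?_).iInf_congr ?_
    · intro r; simp
    · intro r; rfl

theorem ofRatCDF_ratCDF (p : ProbabilityMeasure ℝ) : ofRatCDF (ratCDF p) = p := by
  refine Subtype.ext ?_
  change (ofRatCDF (ratCDF p) : Measure ℝ) = p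
  refine ext_of_generate_finite _
    ((BorelSpace.measurable_eq (α := ℝ)).trans Real.borel_eq_generateFrom_Iic_rat)
    Real.isPiSystem_Iic_rat ?_
    ?_
  · intro s hs
    simp only [mem_iUnion, mem_singleton_iff] at hs
    obtain ⟨q, rfl⟩ := hs
    change (stieltjesOfMeasurableRat (fun c : ℚ → ℝ => c) measurable_id (ratCDF p)).measure _ = _
    rw [measure_stieltjesOfMeasurableRat_Iic, stieltjesOfMeasurableRat_eq,
      toRatCDF_of_isRatStieltjesPoint (isRatStieltjesPoint_ratCDF p), ratCDF_eq_cdf, ofReal_cdf]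
  · rw [measure_univ, measure_univ]

/-- `ofRatCDF` is a measurable left inverse of `ratCDF`, so the range of `ratCDF` is the set of
fixed points of `ratCDF ∘ ofRatCDF`. That set is Borel in `ℚ → ℝ`, and the measurable structure is
transported from it. -/
instance standardBorelSpace_probabilityMeasure_real :
    StandardBorelSpace (ProbabilityMeasure ℝ) := by
  have hs : MeasurableSet {c : ℚ → ℝ | ratCDF (ofRatCDF c) = c} :=
    measurableSet_eq_fun (measurable_ratCDF.comp measurable_ofRatCDF) measurable_id
  have := hs.standardBorel
  exact standardBorelSpace_of_measurableEquiv (β := {c : ℚ → ℝ | ratCDF (ofRatCDF c) = c})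
    { toFun := fun p => ⟨ratCDF p, congrArg ratCDF (ofRatCDF_ratCDF p)⟩
      invFun := fun c => ofRatCDF c
      left_inv := fun p => ofRatCDF_ratCDF p
      right_inv := fun c => Subtype.ext c.2
      measurable_toFun := measurable_ratCDF.subtype_mk
      measurable_invFun := measurable_ofRatCDF.comp measurable_subtype_coe }

end ProbabilityMeasureReal

/-! ### Lower semianalytic functions -/

section LowerSemianalytic

variable {α β : Type*} [MeasurableSpace α] [MeasurableSpace β]

/-- `F` is lower semianalytic: its strict sublevel sets are analytic. -/
def LowerSemianalytic (F : α → EReal) : Prop := ∀ r : ℝ, Souslin {x | F x < r}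

theorem _root_.Measurable.lowerSemianalytic {F : α → EReal} (hF : Measurable F) :
    LowerSemianalytic F :=
  fun _ => (hF measurableSet_Iio).souslin

theorem LowerSemianalytic.comp {F : β → EReal} (hF : LowerSemianalytic F) {g : α → β}
    (hg : Measurable g) : LowerSemianalytic fun x => F (g x) :=
  fun r => (hF r).preimage hg

theorem LowerSemianalytic.souslin_lt {F : α → EReal} (hF : LowerSemianalytic F) {h : α → EReal}
    (hh : Measurable h) : Souslin {x | F x < h x} := by
  have : {x | F x < h x}
      = ⋃ q : ℚ, {x | F x < ((q : ℝ) : EReal)} ∩ {x | ((q : ℝ) : EReal) < h x} := by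
    ext x
    simp only [mem_ofPred_eq, mem_iUnion, mem_inter_iff]
    exact ⟨fun hx => EReal.lt_iff_exists_rat_btwn.1 hx, fun ⟨_, h1, h2⟩ => h1.trans h2⟩
  rw [this]
  exact Souslin.iUnion fun q => (hF q).inter_measurable (hh measurableSet_Ioi)

theorem LowerSemianalytic.souslin_le {F : α → EReal} (hF : LowerSemianalytic F) {h : α → EReal}
    (hh : Measurable h) : Souslin {x | F x ≤ h x} := by
  have : {x | F x ≤ h x}
      = ⋂ q : ℚ, {x | F x < ((q : ℝ) : EReal)} ∪ {x | ((q : ℝ) : EReal) ≤ h x} := by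
    ext x
    simp only [mem_ofPred_eq, mem_iInter, mem_union]
    refine ⟨fun hx q => (lt_or_ge (h x) ((q : ℝ) : EReal)).imp hx.trans_lt id, fun hx => ?_⟩
    by_contra! hlt
    obtain ⟨q, h1, h2⟩ := EReal.lt_iff_exists_rat_btwn.1 hlt
    exact (hx q).elim (fun h => lt_asymm h h2) (fun h => h1.not_ge h)
  rw [this]
  exact Souslin.iInter fun q => (hF q).union (hh measurableSet_Ici).souslin

theorem LowerSemianalytic.universallyMeasurable [StandardBorelSpace α] {F : α → EReal}
    (hF : LowerSemianalytic F) : UniversallyMeasurable F := by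
  intro μ hμ
  have h : Measurable (α := NullMeasurableSpace α μ) F :=
    measurable_of_Iio (δ := NullMeasurableSpace α μ) fun r =>
      (hF.souslin_lt measurable_const).nullMeasurableSet μ
  exact fun s hs => h hs

/-- A strict sublevel set of an infimum is exactly a projection, attained or not; hence the strict
inequality in the definition of `LowerSemianalytic`. -/
theorem LowerSemianalytic.iInf [StandardBorelSpace β] {F : α × β → EReal}
    (hF : LowerSemianalytic F) : LowerSemianalytic fun x => ⨅ u, F (x, u) := by
  intro r
  have : {x | ⨅ u, F (x, u) < r} = Prod.fst '' {p | F p < r} := by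
    ext x
    simp [iInf_lt_iff]
  rw [this]
  exact (hF r).fst_image

/-- Integrals of lower semianalytic functions are lower semianalytic in the parameter. -/
theorem LowerSemianalytic.eintegral {κ : α → ProbabilityMeasure ℝ} (hκ : Measurable κ)
    {F : α × ℝ → EReal} (hF : LowerSemianalytic F) :
    LowerSemianalytic fun y => BayesControl.eintegral (κ y : Measure ℝ) fun z => F (y, z) := by
  intro r
  have hFm : ∀ y, UniversallyMeasurable fun z => F (y, z) := fun y =>
    (hF.comp measurable_prodMk_left).universallyMeasurable
  -- `B` is a Borel set of quadruples `(y, z, q, a)` in which `a` certifies `F (y, z) < q`.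
  obtain ⟨B, hB, hDB⟩ := (hF.comp (measurable_fst (α := α × ℝ) (β := ℝ))).souslin_lt
    (h := fun p => (p.2 : EReal)) measurable_snd.coe_real_ereal
  have hBD : ∀ y z q, F (y, z) < (q : ℝ) ↔ ∃ a, (((y, z), q), a) ∈ B := by
    intro y z q
    have := Set.ext_iff.1 hDB ((y, z), q)
    simpa using this
  -- `ρ` decodes a real number into a triple `(z, q, a)`, so laws of such triples are represented by
  -- elements of `ProbabilityMeasure ℝ`, already known to be standard Borel.
  obtain ⟨ρ, hρ, hρe⟩ : ∃ ρ : ℝ → ℝ × ℝ × ℝ, Measurable ρ ∧ ρ ∘ embeddingReal (ℝ × ℝ × ℝ) = id :=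
    (measurableEmbedding_embeddingReal _).exists_measurable_extend measurable_id
      fun _ => inferInstance
  have he := measurable_embeddingReal (ℝ × ℝ × ℝ)
  have hρe' : ∀ x, ρ (embeddingReal _ x) = x := congrFun hρe
  have h1 : Measurable fun a => (ρ a).1 := measurable_fst.comp hρ
  have h2 : Measurable fun a => (ρ a).2.1 := (measurable_fst.comp measurable_snd).comp hρ
  have h3 : Measurable fun a => (ρ a).2.2 := (measurable_snd.comp measurable_snd).comp hρ
  let K : Kernel (α × ProbabilityMeasure ℝ) ℝ :=
    ⟨fun p => (p.2 : Measure ℝ), measurable_subtype_coe.comp measurable_snd⟩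
  have hK : IsMarkovKernel K := ⟨fun p => inferInstanceAs (IsProbabilityMeasure (p.2 : Measure ℝ))⟩
  let N : Set ((α × ProbabilityMeasure ℝ) × ℝ) :=
    {p | (((p.1.1, (ρ p.2).1), (ρ p.2).2.1), (ρ p.2).2.2) ∉ B}
  have hN : MeasurableSet N := by
    have : Measurable fun p : (α × ProbabilityMeasure ℝ) × ℝ =>
        (((p.1.1, (ρ p.2).1), (ρ p.2).2.1), (ρ p.2).2.2) := by fun_prop
    exact (this hB).compl
  -- A law of `(z, q, a)` belongs to `S` over `y` if `z` has law `κ y`, almost every triple is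
  -- certified by `B`, and `q` has mean below `r`. These conditions are Borel, and the sublevel set
  -- is the projection of `S`.
  let S : Set (α × ProbabilityMeasure ℝ) :=
    {p | p.2.map h1.aemeasurable = κ p.1} ∩ {p | K p (Prod.mk p ⁻¹' N) = 0} ∩
      {p | BayesControl.eintegral (p.2 : Measure ℝ) (fun a => (((ρ a).2.1 : ℝ) : EReal)) < r}
  have hS : MeasurableSet S := by
    refine (MeasurableSet.inter ?_ ?_).inter ?_
    · refine measurableSet_eq_fun ?_ (hκ.comp measurable_fst)
      exact ((Measure.measurable_map _ h1).comp
        (measurable_subtype_coe.comp measurable_snd)).subtype_mk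
    · exact (Kernel.measurable_kernel_prodMk_left hN) (measurableSet_singleton 0)
    · exact ((measurable_eintegral h2.coe_real_ereal).comp
        (measurable_subtype_coe.comp measurable_snd)) measurableSet_Iio
  have hproj : {y | BayesControl.eintegral (κ y : Measure ℝ) (fun z => F (y, z)) < r}
      = Prod.fst '' S := by
    ext y
    constructor
    · intro hy
      -- The strict majorant `h` makes a certified bound `q ≤ h z` available for almost every `z`; a
      -- selection of `(q, a)` then gives the required law.
      obtain ⟨h, hh, hlt, hint⟩ := exists_gt_eintegral_lt ((hFm y).aemeasurable _) hy
      have hD' : MeasurableSet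
          {p : ℝ × ℝ × ℝ | (((y, p.1), p.2.1), p.2.2) ∈ B ∧ p.2.1 ≤ h p.1} := by
        have : Measurable fun p : ℝ × ℝ × ℝ => (((y, p.1), p.2.1), p.2.2) := by fun_prop
        exact (this hB).inter (measurableSet_le (measurable_fst.comp measurable_snd)
          (hh.comp measurable_fst))
      obtain ⟨φ, hφ, hφD⟩ := hD'.souslin.exists_universallyMeasurable_selector
      have hsel : ∀ᵐ z ∂(κ y : Measure ℝ),
          (((y, z), (φ z).1), (φ z).2) ∈ B ∧ (φ z).1 ≤ h z := by
        filter_upwards [hlt] with z hz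
        obtain ⟨a, ha⟩ := (hBD y z (h z)).1 hz
        exact hφD z (h z, a) ⟨ha, le_rfl⟩
      have hφm := hφ.aemeasurable (κ y : Measure ℝ)
      have hem : AEMeasurable (fun z => embeddingReal (ℝ × ℝ × ℝ) (z, φ z)) (κ y : Measure ℝ) :=
        he.comp_aemeasurable (aemeasurable_id.prodMk hφm)
      refine ⟨(y, (κ y).map hem), ⟨⟨?_, ?_⟩, ?_⟩, rfl⟩
      · refine Subtype.ext ?_
        change Measure.map _ (Measure.map _ (κ y : Measure ℝ)) = _
        rw [AEMeasurable.map_map_of_aemeasurable h1.aemeasurable hem]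
        simp [Function.comp_def, hρe']
      · change Measure.map _ (κ y : Measure ℝ) _ = 0
        rw [Measure.map_apply_of_aemeasurable hem (measurable_prodMk_left hN)]
        refine measure_eq_zero_iff_ae_notMem.2 ?_
        filter_upwards [hsel] with z hz
        simpa [N, hρe'] using hz.1
      · change BayesControl.eintegral (Measure.map _ (κ y : Measure ℝ)) _ < _
        rw [eintegral_map hem h2.coe_real_ereal.aemeasurable]
        refine lt_of_le_of_lt (eintegral_mono_ae ?_) hint
        filter_upwards [hsel] with z hz
        simpa [hρe'] using hz.2
    -- Conversely, `F (y, z) < q` almost surely under `ν`, so the integral of `F` is at most the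
    -- mean of `q`.
    · rintro ⟨⟨y, ν⟩, ⟨⟨hmap, hnull⟩, hint⟩, rfl⟩
      have hmap' : (ν : Measure ℝ).map (fun a => (ρ a).1) = κ y := congrArg Subtype.val hmap
      have hnull' : ∀ᵐ a ∂(ν : Measure ℝ), (((y, (ρ a).1), (ρ a).2.1), (ρ a).2.2) ∈ B := hnull
      change BayesControl.eintegral (κ y : Measure ℝ) (fun z => F (y, z)) < r
      have hm := (hFm y).aemeasurable (κ y : Measure ℝ)
      rw [← hmap'] at hm ⊢
      rw [eintegral_map h1.aemeasurable hm]
      refine lt_of_le_of_lt (eintegral_mono_ae ?_) hint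
      filter_upwards [hnull'] with a ha
      exact ((hBD _ _ _).2 ⟨_, ha⟩).le
  rw [hproj]
  exact hS.souslin.fst_image

end LowerSemianalytic

/-! ### The mean of a Dirichlet process -/

section Gamma

theorem measurable_gammaPDF (a r : ℝ) : Measurable (gammaPDF a r) :=
  (measurable_gammaPDFReal a r).ennreal_ofReal

theorem lintegral_gammaMeasure (a r : ℝ) {g : ℝ → ℝ≥0∞} (hg : Measurable g) :
    ∫⁻ x, g x ∂gammaMeasure a r = ∫⁻ x, gammaPDF a r x * g x :=
  lintegral_withDensity_eq_lintegral_mul _ (measurable_gammaPDF a r) hg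

theorem ae_pos_gammaMeasure (a r : ℝ) : ∀ᵐ x ∂gammaMeasure a r, 0 < x := by
  rw [gammaMeasure, ae_withDensity_iff (measurable_gammaPDF a r)]
  have h0 : ∀ᵐ x : ℝ, x ≠ 0 := by simp [ae_iff]
  filter_upwards [h0] with x hx hpdf
  by_contra hle
  exact hpdf (gammaPDF_of_neg (lt_of_le_of_ne (not_lt.1 hle) hx))

/-- The Laplace transform of the Gamma distribution. -/
theorem lintegral_exp_gammaMeasure {b s : ℝ} (hb : 0 < b) (hs : 0 ≤ s) :
    ∫⁻ y, ENNReal.ofReal (Real.exp (-(s * y))) ∂gammaMeasure b 1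
      = ENNReal.ofReal ((1 + s) ^ (-b)) := by
  have h1s : 0 < 1 + s := by linarith
  rw [lintegral_gammaMeasure _ _ (by fun_prop)]
  have h : ∀ y, gammaPDF b 1 y * ENNReal.ofReal (Real.exp (-(s * y)))
      = ENNReal.ofReal ((1 + s) ^ (-b)) * gammaPDF b (1 + s) y := by
    intro y
    rcases lt_or_ge y 0 with hy | hy
    · simp [gammaPDF_of_neg hy]
    · rw [gammaPDF_of_nonneg hy, gammaPDF_of_nonneg hy, ← ENNReal.ofReal_mul' (by positivity),
        ← ENNReal.ofReal_mul (by positivity)]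
      congr 1
      rw [Real.one_rpow, Real.rpow_neg h1s.le,
        show -((1 + s) * y) = -(1 * y) + -(s * y) by ring, Real.exp_add]
      have := (Real.rpow_pos_of_pos h1s b).ne'
      field_simp
  simp_rw [h]
  rw [lintegral_const_mul _ (measurable_gammaPDF _ _), lintegral_gammaPDF_eq_one hb h1s, mul_one]

/-- Size-biasing turns a Gamma distribution of shape `a` into one of shape `a + 1`. -/
theorem lintegral_mul_gammaMeasure {a : ℝ} (ha : 0 < a) {g : ℝ → ℝ≥0∞} (hg : Measurable g) :
    ∫⁻ x, ENNReal.ofReal x * g x ∂gammaMeasure a 1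
      = ENNReal.ofReal a * ∫⁻ x, g x ∂gammaMeasure (a + 1) 1 := by
  rw [lintegral_gammaMeasure _ _ (by fun_prop), lintegral_gammaMeasure _ _ hg,
    ← lintegral_const_mul (f := fun x => gammaPDF (a + 1) 1 x * g x) _
      ((measurable_gammaPDF _ _).mul hg)]
  refine lintegral_congr fun x => ?_
  rw [← mul_assoc, ← mul_assoc]
  congr 1
  rcases lt_or_ge x 0 with hx | hx
  · simp [gammaPDF_of_neg hx]
  · rw [gammaPDF_of_nonneg hx, gammaPDF_of_nonneg hx, ← ENNReal.ofReal_mul' hx,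
      ← ENNReal.ofReal_mul ha.le]
    congr 1
    rw [Real.Gamma_add_one ha.ne', Real.one_rpow, Real.one_rpow, add_sub_cancel_right]
    have hpow : x ^ (a - 1) * x = x ^ a := by
      rcases hx.eq_or_lt with rfl | hx
      · simp [Real.zero_rpow ha.ne']
      · rw [Real.rpow_sub_one hx.ne']; field_simp
    rw [← hpow]
    have := (Real.Gamma_pos_of_pos ha).ne'
    field_simp

/-- Normalization of the exponential density with rate `x + y`. The product form separates the two
Gamma variables after Tonelli's theorem. -/
theorem lintegral_exp_mul_exp {x y : ℝ} (hx : 0 < x) (hy : 0 < y) :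
    ∫⁻ s in Ioi (0 : ℝ), ENNReal.ofReal (Real.exp (-(s * x))) * ENNReal.ofReal (Real.exp (-(s * y)))
      = ENNReal.ofReal ((x + y)⁻¹) := by
  have hxy : 0 < x + y := add_pos hx hy
  have h1 : ∫⁻ s in Ioi (0 : ℝ), exponentialPDF (x + y) s = 1 := by
    rw [← lintegral_exponentialPDF_eq_one hxy, ← lintegral_indicator measurableSet_Ioi]
    have h0 : ∀ᵐ s : ℝ, s ≠ 0 := by simp [ae_iff]
    refine lintegral_congr_ae ?_
    filter_upwards [h0] with s hs
    by_cases h : s ∈ Ioi (0 : ℝ)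
    · rw [indicator_of_mem h]
    · rw [indicator_of_notMem h,
        exponentialPDF_of_neg (lt_of_le_of_ne (not_lt.1 h) hs)]
  have h2 : ∀ s ∈ Ioi (0 : ℝ), ENNReal.ofReal (Real.exp (-(s * x))) *
      ENNReal.ofReal (Real.exp (-(s * y)))
      = ENNReal.ofReal ((x + y)⁻¹) * exponentialPDF (x + y) s := by
    intro s hs
    rw [exponentialPDF_of_nonneg (le_of_lt hs), ← ENNReal.ofReal_mul (by positivity),
      ← ENNReal.ofReal_mul (by positivity), ← Real.exp_add]
    congr 1
    rw [show -(s * x) + -(s * y) = -((x + y) * s) by ring]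
    field_simp
  rw [setLIntegral_congr_fun measurableSet_Ioi h2,
    lintegral_const_mul' _ _ ENNReal.ofReal_ne_top, h1, mul_one]

theorem lintegral_inv_add_gammaMeasure {a b : ℝ} (ha : 0 < a) (hb : 0 < b) :
    ∫⁻ x, ∫⁻ y, ENNReal.ofReal ((x + y)⁻¹) ∂gammaMeasure b 1 ∂gammaMeasure a 1
      = ∫⁻ s in Ioi (0 : ℝ), ENNReal.ofReal ((1 + s) ^ (-(a + b))) := by
  have := isProbabilityMeasure_gammaMeasure ha one_pos
  have := isProbabilityMeasure_gammaMeasure hb one_pos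
  let E : ℝ → ℝ → ℝ≥0∞ := fun s x => ENNReal.ofReal (Real.exp (-(s * x)))
  have hE : Measurable fun p : ℝ × ℝ => E p.1 p.2 := by fun_prop
  have hEs : ∀ s, Measurable (E s) := fun s => hE.comp measurable_prodMk_left
  have hint : ∀ᵐ x ∂gammaMeasure a 1, ∫⁻ y, ENNReal.ofReal ((x + y)⁻¹) ∂gammaMeasure b 1
      = ∫⁻ s in Ioi (0 : ℝ), E s x * ∫⁻ y, E s y ∂gammaMeasure b 1 := by
    filter_upwards [ae_pos_gammaMeasure a 1] with x hx
    calc ∫⁻ y, ENNReal.ofReal ((x + y)⁻¹) ∂gammaMeasure b 1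
        = ∫⁻ y, (∫⁻ s in Ioi (0 : ℝ), E s x * E s y) ∂gammaMeasure b 1 :=
          lintegral_congr_ae ((ae_pos_gammaMeasure b 1).mono fun y hy =>
            (lintegral_exp_mul_exp hx hy).symm)
      _ = ∫⁻ s in Ioi (0 : ℝ), ∫⁻ y, E s x * E s y ∂gammaMeasure b 1 :=
          lintegral_lintegral_swap (f := fun y s => E s x * E s y) (by fun_prop)
      _ = _ := lintegral_congr fun s => lintegral_const_mul _ (hEs s)
  have hEm : Measurable fun s => ∫⁻ y, E s y ∂gammaMeasure b 1 := hE.lintegral_prod_right'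
  rw [lintegral_congr_ae hint, lintegral_lintegral_swap
    (f := fun x s => E s x * ∫⁻ y, E s y ∂gammaMeasure b 1) (by fun_prop)]
  refine setLIntegral_congr_fun measurableSet_Ioi fun s hs => ?_
  have hs' : (0 : ℝ) < s := hs
  change ∫⁻ x, E s x * ∫⁻ y, E s y ∂gammaMeasure b 1 ∂gammaMeasure a 1 = _
  rw [lintegral_mul_const _ (hEs s), lintegral_exp_gammaMeasure ha hs'.le,
    lintegral_exp_gammaMeasure hb hs'.le, ← ENNReal.ofReal_mul (by positivity),
    ← Real.rpow_add (by positivity), neg_add]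

/-- The factor `x` is absorbed by size-biasing, which raises the shape to `a + 1`. The integral that
remains depends only on `a + b`. -/
theorem lintegral_div_add_gammaMeasure {a b : ℝ} (ha : 0 < a) (hb : 0 < b) :
    ∫⁻ x, ∫⁻ y, ENNReal.ofReal (x / (x + y)) ∂gammaMeasure b 1 ∂gammaMeasure a 1
      = ENNReal.ofReal a * ∫⁻ s in Ioi (0 : ℝ), ENNReal.ofReal ((1 + s) ^ (-(a + b + 1))) := by
  have := isProbabilityMeasure_gammaMeasure hb one_pos
  have hm : Measurable fun p : ℝ × ℝ => ENNReal.ofReal ((p.1 + p.2)⁻¹) := by fun_prop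
  have h : ∀ᵐ x ∂gammaMeasure a 1, ∫⁻ y, ENNReal.ofReal (x / (x + y)) ∂gammaMeasure b 1
      = ENNReal.ofReal x * ∫⁻ y, ENNReal.ofReal ((x + y)⁻¹) ∂gammaMeasure b 1 := by
    filter_upwards [ae_pos_gammaMeasure a 1] with x hx
    rw [← lintegral_const_mul _ (by fun_prop)]
    exact lintegral_congr fun y => by rw [div_eq_mul_inv, ENNReal.ofReal_mul hx.le]
  rw [lintegral_congr_ae h, lintegral_mul_gammaMeasure ha hm.lintegral_prod_right',
    lintegral_inv_add_gammaMeasure (by linarith) hb]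
  simp_rw [show a + 1 + b = a + b + 1 by ring]

/-- The means of `X / (X + Y)` and `Y / (X + Y)` are `a * I` and `b * I` with the same `I`, and they
sum to `1`. Hence `I = 1 / (a + b)` without evaluating the integral. -/
theorem lintegral_div_add_gammaMeasure_eq {a b : ℝ} (ha : 0 < a) (hb : 0 < b) :
    ∫⁻ x, ∫⁻ y, ENNReal.ofReal (x / (x + y)) ∂gammaMeasure b 1 ∂gammaMeasure a 1
      = ENNReal.ofReal (a / (a + b)) := by
  have := isProbabilityMeasure_gammaMeasure ha one_pos
  have := isProbabilityMeasure_gammaMeasure hb one_pos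
  set I := ∫⁻ s in Ioi (0 : ℝ), ENNReal.ofReal ((1 + s) ^ (-(a + b + 1))) with hI
  have hm1 : Measurable fun p : ℝ × ℝ => ENNReal.ofReal (p.1 / (p.1 + p.2)) := by fun_prop
  have hm2 : Measurable fun p : ℝ × ℝ => ENNReal.ofReal (p.2 / (p.2 + p.1)) := by fun_prop
  have h1 := lintegral_div_add_gammaMeasure ha hb
  have h2 : ∫⁻ x, ∫⁻ y, ENNReal.ofReal (y / (y + x)) ∂gammaMeasure b 1 ∂gammaMeasure a 1
      = ENNReal.ofReal b * I := by
    rw [lintegral_lintegral_swap hm2.aemeasurable, lintegral_div_add_gammaMeasure hb ha]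
    simp_rw [hI, add_comm b a]
  have hsum : ENNReal.ofReal (a + b) * I = 1 := by
    rw [ENNReal.ofReal_add ha.le hb.le, add_mul, ← h1, ← h2,
      ← lintegral_add_left hm1.lintegral_prod_right']
    have : ∀ᵐ x ∂gammaMeasure a 1, ∫⁻ y, ENNReal.ofReal (x / (x + y)) ∂gammaMeasure b 1
        + ∫⁻ y, ENNReal.ofReal (y / (y + x)) ∂gammaMeasure b 1 = 1 := by
      filter_upwards [ae_pos_gammaMeasure a 1] with x hx
      rw [← lintegral_add_left (by fun_prop)]
      have h : ∀ᵐ y ∂gammaMeasure b 1,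
          ENNReal.ofReal (x / (x + y)) + ENNReal.ofReal (y / (y + x)) = 1 := by
        filter_upwards [ae_pos_gammaMeasure b 1] with y hy
        rw [← ENNReal.ofReal_add (by positivity) (by positivity), add_comm y x, ← add_div,
          div_self (by positivity), ENNReal.ofReal_one]
      rw [lintegral_congr_ae h]
      simp
    rw [lintegral_congr_ae this]
    simp
  have hinv : I = (ENNReal.ofReal (a + b))⁻¹ :=
    ENNReal.eq_inv_of_mul_eq_one_left (by rw [mul_comm]; exact hsum)
  rw [h1, ENNReal.ofReal_div_of_pos (add_pos ha hb), ← hI, hinv, div_eq_mul_inv]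

end Gamma

/-! ### From two-cell Dirichlet distributions to the mean measure -/

section Dirichlet

theorem lintegral_dirichletDistribution_two {a : Fin 2 → ℝ} (ha : ∀ i, 0 ≤ a i) :
    ∫⁻ v, ENNReal.ofReal (v 0) ∂dirichletDistribution a = ENNReal.ofReal (a 0 / (a 0 + a 1)) := by
  let m : Fin 2 → Measure ℝ := fun i =>
    if a i = 0 then Measure.dirac (0 : ℝ) else gammaMeasure (a i) 1
  have hm : ∀ i, IsProbabilityMeasure (m i) := by
    intro i
    by_cases h : a i = 0
    · simp only [m, if_pos h]; infer_instance
    · simp only [m, if_neg h]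
      exact isProbabilityMeasure_gammaMeasure (lt_of_le_of_ne (ha i) (Ne.symm h)) one_pos
  have hF : Measurable fun p : ℝ × ℝ => ENNReal.ofReal (p.1 / (p.1 + p.2)) := by fun_prop
  have h1 : ∫⁻ v, ENNReal.ofReal (v 0) ∂dirichletDistribution a
      = ∫⁻ x, ∫⁻ y, ENNReal.ofReal (x / (x + y)) ∂m 1 ∂m 0 := by
    rw [dirichletDistribution, lintegral_map (by fun_prop) (by fun_prop),
      ← lintegral_prod _ hF.aemeasurable,
      ← (measurePreserving_piFinTwo m).lintegral_comp_emb
        (MeasurableEquiv.measurableEmbedding _)]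
    refine lintegral_congr fun z => ?_
    simp [Fin.sum_univ_two]
  rw [h1]
  -- Vanishing parameters give point masses at `0` and are treated separately; if both vanish, the
  -- two sides agree through `0 / 0 = 0`.
  by_cases h0 : a 0 = 0
  · simp [m, h0]
  have ha0 : 0 < a 0 := lt_of_le_of_ne (ha 0) (Ne.symm h0)
  by_cases h1 : a 1 = 0
  · have hm0 : m 0 = gammaMeasure (a 0) 1 := by simp [m, h0]
    have hm1 : m 1 = Measure.dirac 0 := by simp [m, h1]
    have : ∀ᵐ x ∂m 0, ∫⁻ y, ENNReal.ofReal (x / (x + y)) ∂m 1 = 1 := by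
      rw [hm0, hm1]
      filter_upwards [ae_pos_gammaMeasure (a 0) 1] with x hx
      rw [lintegral_dirac, add_zero, div_self hx.ne', ENNReal.ofReal_one]
    rw [lintegral_congr_ae this, h1, add_zero, div_self h0]
    simp
  · have ha1 : 0 < a 1 := lt_of_le_of_ne (ha 1) (Ne.symm h1)
    simp only [m, if_neg h0, if_neg h1]
    exact lintegral_div_add_gammaMeasure_eq ha0 ha1

/-- A random probability measure drawn from a Dirichlet process with parameter `c • P` has mean
measure `P`. -/
theorem IsDirichletProcess.lintegral_apply {c : ℝ≥0} (hc : 0 < c) {P : ProbabilityMeasure ℝ}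
    {π : Measure (ProbabilityMeasure ℝ)} (h : IsDirichletProcess (c • (P : Measure ℝ)) π)
    {B : Set ℝ} (hB : MeasurableSet B) :
    ∫⁻ p, (p : Measure ℝ) B ∂π = (P : Measure ℝ) B := by
  have hev : ∀ s : Set ℝ, MeasurableSet s →
      Measurable fun p : ProbabilityMeasure ℝ => (p : Measure ℝ) s := fun s hs =>
    (Measure.measurable_coe hs).comp measurable_subtype_coe
  let C : Fin 2 → Set ℝ := ![B, Bᶜ]
  have hC : ∀ i, MeasurableSet (C i) := by
    intro i; fin_cases i
    · exact hB
    · exact hB.compl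
  have hdisj : Pairwise fun i j => Disjoint (C i) (C j) := by
    intro i j hij
    fin_cases i <;> fin_cases j <;> simp [C] at hij ⊢
    · exact disjoint_compl_right
    · exact disjoint_compl_left
  have hU : (⋃ i, C i) = univ := by
    ext x
    simp [C, Fin.exists_fin_two, em]
  have hmap := h.2 2 C hC hdisj hU
  have hmeas : Measurable fun (p : ProbabilityMeasure ℝ) i => ((p : Measure ℝ) (C i)).toReal :=
    measurable_pi_lambda _ fun i => (hev _ (hC i)).ennreal_toReal
  have hsum : ((c • (P : Measure ℝ)) (C 0)).toReal + ((c • (P : Measure ℝ)) (C 1)).toReal = c := by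
    rw [← ENNReal.toReal_add (measure_ne_top _ _) (measure_ne_top _ _)]
    change ((c • (P : Measure ℝ)) B + (c • (P : Measure ℝ)) Bᶜ).toReal = c
    rw [measure_add_measure_compl hB]
    simp only [Measure.smul_apply, ENNReal.smul_def, smul_eq_mul, measure_univ, mul_one,
      ENNReal.coe_toReal]
  calc ∫⁻ p, (p : Measure ℝ) B ∂π
      = ∫⁻ p, ENNReal.ofReal (((p : Measure ℝ) (C 0)).toReal) ∂π :=
        lintegral_congr fun p => (ENNReal.ofReal_toReal (measure_ne_top _ _)).symm
    _ = ∫⁻ v, ENNReal.ofReal (v 0) ∂dirichletDistribution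
          fun i => ((c • (P : Measure ℝ)) (C i)).toReal := by
        rw [← hmap, lintegral_map (by fun_prop) hmeas]
    _ = ENNReal.ofReal (((c • (P : Measure ℝ)) (C 0)).toReal / c) := by
        rw [lintegral_dirichletDistribution_two fun i => ENNReal.toReal_nonneg, hsum]
    _ = (P : Measure ℝ) B := by
        have hc' : (c : ℝ) ≠ 0 := by exact_mod_cast hc.ne'
        have : ((c • (P : Measure ℝ)) (C 0)).toReal = c * ((P : Measure ℝ) B).toReal := by
          change ((c • (P : Measure ℝ)) B).toReal = _
          rw [Measure.smul_apply, ENNReal.smul_def, smul_eq_mul, ENNReal.toReal_mul,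
            ENNReal.coe_toReal]
        rw [this, mul_div_cancel_left₀ _ hc', ENNReal.ofReal_toReal (measure_ne_top _ _)]

/-- The default branch `Measure.dirac P` also has mean measure `P`, so the existence of the
Dirichlet process need not be proved. -/
theorem lintegral_dirichletProcess_apply {c : ℝ≥0} (hc : 0 < c) (P : ProbabilityMeasure ℝ)
    {B : Set ℝ} (hB : MeasurableSet B) :
    ∫⁻ p, (p : Measure ℝ) B ∂(dirichletProcess c P) = (P : Measure ℝ) B := by
  unfold dirichletProcess
  split_ifs with h
  · exact h.choose_spec.lintegral_apply hc hB
  · exact lintegral_dirac' _ ((Measure.measurable_coe hB).comp measurable_subtype_coe)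

end Dirichlet

/-! ### The law of the controlled process -/

section Laws

variable {d k : ℕ} {U : Set (EuclideanSpace ℝ (Fin k))}

theorem map_bind_measure {α β γ : Type*} [MeasurableSpace α] [MeasurableSpace β]
    [MeasurableSpace γ] {μ : Measure α} {κ : α → Measure β} (hκ : AEMeasurable κ μ) {g : β → γ}
    (hg : Measurable g) : (μ.bind κ).map g = μ.bind fun x => (κ x).map g := by
  simp_rw [← Measure.bind_dirac_eq_map _ hg]
  exact Measure.bind_bind hκ (Measure.measurable_dirac.comp hg).aemeasurable

theorem measurable_map_measure {α β γ : Type*} [MeasurableSpace α] [MeasurableSpace β]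
    [MeasurableSpace γ] {κ : α → ProbabilityMeasure β} (hκ : Measurable κ) {g : α → β → γ}
    (hg : Measurable fun p : α × β => g p.1 p.2) :
    Measurable fun x => (κ x : Measure β).map (g x) := by
  let K : Kernel α β := ⟨fun x => (κ x : Measure β), measurable_subtype_coe.comp hκ⟩
  have hK : IsMarkovKernel K := ⟨fun x => inferInstanceAs (IsProbabilityMeasure (κ x : Measure β))⟩
  refine Measure.measurable_of_measurable_coe _ fun s hs => ?_
  have : (fun x => ((κ x : Measure β).map (g x)) s)
      = fun x => K x (Prod.mk x ⁻¹' {p | g p.1 p.2 ∈ s}) := by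
    funext x
    have hx : Measurable (g x) := hg.comp measurable_prodMk_left
    rw [Measure.map_apply hx hs]
    rfl
  rw [this]
  exact Kernel.measurable_kernel_prodMk_left (hg hs)

theorem measurable_posteriorMean (c₀ : ℝ≥0) (t : ℕ) :
    Measurable fun p : ProbabilityMeasure ℝ × ℝ => posteriorMean c₀ t p.1 p.2 := by
  refine Measurable.subtype_mk (Measure.measurable_of_measurable_coe _ fun s hs => ?_)
  have h1 : Measurable fun p : ProbabilityMeasure ℝ × ℝ => (p.1 : Measure ℝ) s :=
    (Measure.measurable_coe hs).comp (measurable_subtype_coe.comp measurable_fst)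
  have h2 : Measurable fun p : ProbabilityMeasure ℝ × ℝ => Measure.dirac p.2 s :=
    (Measure.measurable_coe hs).comp (Measure.measurable_dirac.comp measurable_snd)
  simp only [Measure.smul_apply, Measure.add_apply, ENNReal.smul_def, smul_eq_mul]
  exact ((h1.const_mul _).add h2).const_mul _

variable {f : EuclideanSpace ℝ (Fin d) → U → ℝ → EuclideanSpace ℝ (Fin d)}

theorem measurable_stateUpdate
    (hf : Continuous fun p : EuclideanSpace ℝ (Fin d) × U × ℝ => f p.1 p.2.1 p.2.2) (c₀ : ℝ≥0)
    (t : ℕ) : Measurable fun p : (State d × U) × ℝ => stateUpdate f c₀ t p.1.1 p.1.2 p.2 := by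
  refine Measurable.prodMk ?_ ?_
  · exact hf.measurable.comp (g := fun p : EuclideanSpace ℝ (Fin d) × U × ℝ => f p.1 p.2.1 p.2.2)
      (f := fun p : (State d × U) × ℝ => (p.1.1.1, p.1.2, p.2)) (by fun_prop)
  · exact (measurable_posteriorMean c₀ t).comp
      (f := fun p : (State d × U) × ℝ => (p.1.1.2, p.2)) (by fun_prop)

/-- One step of the augmented state, with the innovation drawn from the posterior mean measure. -/
noncomputable def meanTransition
    (f : EuclideanSpace ℝ (Fin d) → U → ℝ → EuclideanSpace ℝ (Fin d)) (c₀ : ℝ≥0)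
    (t : ℕ) (x : State d) (u : U) : Measure (State d) :=
  (x.2 : Measure ℝ).map (stateUpdate f c₀ t x u)

theorem measurable_meanTransition
    (hf : Continuous fun p : EuclideanSpace ℝ (Fin d) × U × ℝ => f p.1 p.2.1 p.2.2) (c₀ : ℝ≥0)
    (t : ℕ) : Measurable fun p : State d × U => meanTransition f c₀ t p.1 p.2 :=
  measurable_map_measure (κ := fun p : State d × U => p.1.2)
    (g := fun p => stateUpdate f c₀ t p.1 p.2) (by fun_prop) (measurable_stateUpdate hf c₀ t)

theorem measurable_stateUpdate_right
    (hf : Continuous fun p : EuclideanSpace ℝ (Fin d) × U × ℝ => f p.1 p.2.1 p.2.2) (c₀ : ℝ≥0)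
    (t : ℕ) (x : State d) (u : U) : Measurable (stateUpdate f c₀ t x u) :=
  (measurable_stateUpdate hf c₀ t).comp (measurable_prodMk_left (x := (x, u)))

theorem isProbabilityMeasure_meanTransition
    (hf : Continuous fun p : EuclideanSpace ℝ (Fin d) × U × ℝ => f p.1 p.2.1 p.2.2) (c₀ : ℝ≥0)
    (t : ℕ) (x : State d) (u : U) : IsProbabilityMeasure (meanTransition f c₀ t x u) :=
  Measure.isProbabilityMeasure_map (measurable_stateUpdate_right hf c₀ t x u).aemeasurable

/-- `Q` depends on the prior only linearly, through the integral of `p ↦ p (G⁻¹ s)`, so only the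
mean measure of the Dirichlet process matters. -/
theorem transition_eq_meanTransition
    (hf : Continuous fun p : EuclideanSpace ℝ (Fin d) × U × ℝ => f p.1 p.2.1 p.2.2) {c₀ : ℝ≥0}
    (hc₀ : 0 < c₀) (t : ℕ) (x : State d) (u : U) :
    transition f c₀ t x u = meanTransition f c₀ t x u := by
  have hG := measurable_stateUpdate_right hf c₀ t x u
  ext s hs
  rw [transition, meanTransition, Measure.bind_apply hs, Measure.map_apply hG hs]
  · simp_rw [Measure.map_apply hG hs]
    exact lintegral_dirichletProcess_apply (by positivity) _ (hG hs)
  · exact ((Measure.measurable_map _ hG).comp measurable_subtype_coe).aemeasurable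

/-- One step of the augmented state under the policy `φ`. -/
noncomputable def policyStep (f : EuclideanSpace ℝ (Fin d) → U → ℝ → EuclideanSpace ℝ (Fin d))
    (c₀ : ℝ≥0) (φ : Policy d U) (t : ℕ) (x : State d) : Measure (State d) :=
  meanTransition f c₀ t x (φ.1 t x)

theorem isProbabilityMeasure_policyStep
    (hf : Continuous fun p : EuclideanSpace ℝ (Fin d) × U × ℝ => f p.1 p.2.1 p.2.2) (c₀ : ℝ≥0)
    (φ : Policy d U) (t : ℕ) (x : State d) : IsProbabilityMeasure (policyStep f c₀ φ t x) :=
  isProbabilityMeasure_meanTransition hf c₀ t x _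

theorem aemeasurable_policyStep
    (hf : Continuous fun p : EuclideanSpace ℝ (Fin d) × U × ℝ => f p.1 p.2.1 p.2.2) (c₀ : ℝ≥0)
    (φ : Policy d U) (t : ℕ) (μ : Measure (State d)) [IsProbabilityMeasure μ] :
    AEMeasurable (policyStep f c₀ φ t) μ :=
  (measurable_meanTransition hf c₀ t).comp_aemeasurable
    (aemeasurable_id.prodMk ((φ.2 t).aemeasurable μ))

theorem isProbabilityMeasure_bind_policyStep
    (hf : Continuous fun p : EuclideanSpace ℝ (Fin d) × U × ℝ => f p.1 p.2.1 p.2.2) (c₀ : ℝ≥0)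
    (φ : Policy d U) (t : ℕ) (μ : Measure (State d)) [IsProbabilityMeasure μ] :
    IsProbabilityMeasure (μ.bind (policyStep f c₀ φ t)) :=
  isProbabilityMeasure_bind (aemeasurable_policyStep hf c₀ φ t μ)
    (ae_of_all _ fun x => isProbabilityMeasure_policyStep hf c₀ φ t x)

/-- The law of the state after `n` steps from the state `x` at time `t`. -/
noncomputable def stateLaw (f : EuclideanSpace ℝ (Fin d) → U → ℝ → EuclideanSpace ℝ (Fin d))
    (c₀ : ℝ≥0) (φ : Policy d U) : ℕ → ℕ → State d → Measure (State d)
  | 0, _, x => Measure.dirac x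
  | n + 1, t, x => (policyStep f c₀ φ t x).bind (stateLaw f c₀ φ n (t + 1))

/-- Policies are only universally measurable, so these laws form a kernel only up to null sets. The
induction ranges over all `μ` because the later steps must be measurable for the pushed-forward law.
-/
theorem aemeasurable_stateLaw
    (hf : Continuous fun p : EuclideanSpace ℝ (Fin d) × U × ℝ => f p.1 p.2.1 p.2.2) (c₀ : ℝ≥0)
    (φ : Policy d U) (n t : ℕ) (μ : Measure (State d)) [IsProbabilityMeasure μ] :
    AEMeasurable (stateLaw f c₀ φ n t) μ := by
  induction n generalizing t μ with
  | zero => exact Measure.measurable_dirac.aemeasurable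
  | succ n ih =>
    have := isProbabilityMeasure_bind_policyStep hf c₀ φ t μ
    have h := ih (t + 1) (μ.bind (policyStep f c₀ φ t))
    exact (Measure.aemeasurable_bind h).comp_aemeasurable (aemeasurable_policyStep hf c₀ φ t μ)

theorem bind_stateLaw_zero (c₀ : ℝ≥0) (φ : Policy d U) (t : ℕ) (μ : Measure (State d)) :
    μ.bind (stateLaw f c₀ φ 0 t) = μ :=
  Measure.bind_dirac

theorem bind_stateLaw_succ
    (hf : Continuous fun p : EuclideanSpace ℝ (Fin d) × U × ℝ => f p.1 p.2.1 p.2.2) (c₀ : ℝ≥0)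
    (φ : Policy d U) (n t : ℕ) (μ : Measure (State d)) [IsProbabilityMeasure μ] :
    μ.bind (stateLaw f c₀ φ (n + 1) t)
      = (μ.bind (policyStep f c₀ φ t)).bind (stateLaw f c₀ φ n (t + 1)) := by
  have := isProbabilityMeasure_bind_policyStep hf c₀ φ t μ
  exact (Measure.bind_bind (aemeasurable_policyStep hf c₀ φ t μ)
    (aemeasurable_stateLaw hf c₀ φ n (t + 1) _)).symm

theorem stateLaw_congr {c₀ : ℝ≥0} {φ ψ : Policy d U} (n t : ℕ)
    (h : ∀ s, t ≤ s → φ.1 s = ψ.1 s) : stateLaw f c₀ φ n t = stateLaw f c₀ ψ n t := by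
  induction n generalizing t with
  | zero => rfl
  | succ n ih =>
    funext x
    simp only [stateLaw, policyStep, h t le_rfl, ih (t + 1) fun s hs => h s (by omega)]

/-- No measurability of `κ` is required, since `κ` is almost everywhere constant for a point mass.
-/
theorem dirac_bind_of_singleton {α β : Type*} [MeasurableSpace α] [MeasurableSpace β]
    [MeasurableSingletonClass α] (κ : α → Measure β) (x : α) : (Measure.dirac x).bind κ = κ x := by
  have h : κ =ᵐ[Measure.dirac x] fun _ => κ x := by
    rw [ae_dirac_eq]; rfl
  rw [Measure.bind_congr_right h, Measure.bind_const, measure_univ, one_smul]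

theorem measurable_finCons {n : ℕ} (x : State d) :
    Measurable fun ω : Fin n → State d => (Fin.cons x ω : Fin (n + 1) → State d) := by
  refine measurable_pi_lambda _ fun i => ?_
  refine Fin.cases ?_ (fun j => ?_) i
  · simp only [Fin.cons_zero]; fun_prop
  · simp only [Fin.cons_succ]; fun_prop

theorem futureLaw_succ
    (hf : Continuous fun p : EuclideanSpace ℝ (Fin d) × U × ℝ => f p.1 p.2.1 p.2.2) {c₀ : ℝ≥0}
    (hc₀ : 0 < c₀) (φ : Policy d U) (n t : ℕ) (x : State d) :
    futureLaw f c₀ φ t (n + 1) x = (policyStep f c₀ φ t x).bind fun x' =>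
        (futureLaw f c₀ φ (t + 1) n x').map
          fun ω => (Fin.cons x' ω : Fin (n + 1) → State d) := by
  rw [futureLaw, transition_eq_meanTransition hf hc₀]
  rfl

/-- The laws of the future states are probability measures that depend on the current state in a
universally measurable way. -/
theorem isProbabilityMeasure_and_aemeasurable_futureLaw
    (hf : Continuous fun p : EuclideanSpace ℝ (Fin d) × U × ℝ => f p.1 p.2.1 p.2.2) {c₀ : ℝ≥0}
    (hc₀ : 0 < c₀) (φ : Policy d U) (n t : ℕ) :
    (∀ x, IsProbabilityMeasure (futureLaw f c₀ φ t n x)) ∧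
      ∀ (μ : Measure (State d)) [IsProbabilityMeasure μ],
        AEMeasurable (fun x => (futureLaw f c₀ φ t n x).map
          fun ω => (Fin.cons x ω : Fin (n + 1) → State d)) μ := by
  have key : ∀ t n, (∀ x, IsProbabilityMeasure (futureLaw f c₀ φ t n x)) →
      (∀ (μ : Measure (State d)) [IsProbabilityMeasure μ],
        AEMeasurable (futureLaw f c₀ φ t n) μ) →
      ∀ (μ : Measure (State d)) [IsProbabilityMeasure μ],
        AEMeasurable (fun x => (futureLaw f c₀ φ t n x).map
          fun ω => (Fin.cons x ω : Fin (n + 1) → State d)) μ := by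
    intro t n hp hm μ _
    -- Bundling the laws as probability measures makes the pushforward under `Fin.cons` a Borel
    -- function of the pair (state, law).
    have hP : AEMeasurable (fun x => (⟨futureLaw f c₀ φ t n x, hp x⟩ :
        ProbabilityMeasure (Fin n → State d))) μ := (hm μ).subtype_mk
    have hcons : Measurable fun p : (State d × ProbabilityMeasure (Fin n → State d)) ×
        (Fin n → State d) => (Fin.cons p.1.1 p.2 : Fin (n + 1) → State d) := by
      refine measurable_pi_lambda _ fun i => ?_
      refine Fin.cases ?_ (fun j => ?_) i
      · simp only [Fin.cons_zero]; fun_prop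
      · simp only [Fin.cons_succ]; fun_prop
    exact (measurable_map_measure (κ := fun p : State d × ProbabilityMeasure (Fin n → State d) =>
      p.2) (g := fun p ω => (Fin.cons p.1 ω : Fin (n + 1) → State d)) measurable_snd
      hcons).comp_aemeasurable (aemeasurable_id.prodMk hP)
  suffices h : (∀ x, IsProbabilityMeasure (futureLaw f c₀ φ t n x)) ∧
      ∀ (μ : Measure (State d)) [IsProbabilityMeasure μ], AEMeasurable (futureLaw f c₀ φ t n) μ from
    ⟨h.1, key t n h.1 h.2⟩
  induction n generalizing t with
  | zero =>
    exact ⟨fun x => Measure.dirac.isProbabilityMeasure, fun μ _ => aemeasurable_const⟩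
  | succ n ih =>
    obtain ⟨hp, hm⟩ := ih (t + 1)
    have hm' := key (t + 1) n hp hm
    constructor
    · intro x
      rw [futureLaw_succ hf hc₀]
      have := isProbabilityMeasure_policyStep hf c₀ φ t x
      refine isProbabilityMeasure_bind (hm' _) (ae_of_all _ fun x' => ?_)
      have := hp x'
      exact Measure.isProbabilityMeasure_map (measurable_finCons x').aemeasurable
    · intro μ _
      have := isProbabilityMeasure_bind_policyStep hf c₀ φ t μ
      rw [funext (futureLaw_succ hf hc₀ φ n t)]
      exact (Measure.aemeasurable_bind (hm' (μ.bind (policyStep f c₀ φ t)))).comp_aemeasurable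
        (aemeasurable_policyStep hf c₀ φ t μ)

theorem map_last_futureLaw
    (hf : Continuous fun p : EuclideanSpace ℝ (Fin d) × U × ℝ => f p.1 p.2.1 p.2.2) {c₀ : ℝ≥0}
    (hc₀ : 0 < c₀) (φ : Policy d U) (n t : ℕ) (x : State d) :
    ((futureLaw f c₀ φ t n x).map fun ω => (Fin.cons x ω : Fin (n + 1) → State d) (Fin.last n))
      = stateLaw f c₀ φ n t x := by
  induction n generalizing t x with
  | zero =>
    exact (Measure.map_dirac' ((measurable_pi_apply (Fin.last 0)).comp (measurable_finCons x))
      _).trans rfl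
  | succ n ih =>
    have := isProbabilityMeasure_policyStep hf c₀ φ t x
    have h1 : (fun ω : Fin (n + 1) → State d => (Fin.cons x ω : Fin (n + 2) → State d)
        (Fin.last (n + 1))) = fun ω => ω (Fin.last n) := by
      funext ω
      rw [← Fin.succ_last, Fin.cons_succ]
    have hm := (isProbabilityMeasure_and_aemeasurable_futureLaw hf hc₀ φ n (t + 1)).2
      (policyStep f c₀ φ t x)
    have hl : Measurable fun ω : Fin (n + 1) → State d => ω (Fin.last n) := by fun_prop
    rw [h1, futureLaw_succ hf hc₀, map_bind_measure hm hl, stateLaw]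
    congr 1
    funext x'
    rw [Measure.map_map hl (measurable_finCons x'), ← ih]
    rfl

end Laws

/-! ### Dynamic programming -/

section DynamicProgramming

variable {d k : ℕ} {U : Set (EuclideanSpace ℝ (Fin k))}
  {f : EuclideanSpace ℝ (Fin d) → U → ℝ → EuclideanSpace ℝ (Fin d)}

theorem LowerSemianalytic.stepExpectation
    (hf : Continuous fun p : EuclideanSpace ℝ (Fin d) × U × ℝ => f p.1 p.2.1 p.2.2) (c₀ : ℝ≥0)
    (t : ℕ) {W : State d → EReal} (hW : LowerSemianalytic W) :
    LowerSemianalytic fun p : State d × U => BayesControl.stepExpectation f c₀ t W p.1 p.2 :=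
  LowerSemianalytic.eintegral (κ := fun p : State d × U => p.1.2) (by fun_prop)
    (hW.comp (measurable_stateUpdate hf c₀ t))

theorem lowerSemianalytic_bellmanIterate [StandardBorelSpace U]
    (hf : Continuous fun p : EuclideanSpace ℝ (Fin d) × U × ℝ => f p.1 p.2.1 p.2.2) (c₀ : ℝ≥0)
    {ℓ : EuclideanSpace ℝ (Fin d) → ℝ} (hℓ : Measurable ℓ) (t n : ℕ) :
    LowerSemianalytic (bellmanIterate f c₀ ℓ t n) := by
  induction n generalizing t with
  | zero => exact (hℓ.comp measurable_fst).coe_real_ereal.lowerSemianalytic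
  | succ n ih => exact ((ih (t + 1)).stepExpectation hf c₀ t).iInf

theorem universallyMeasurable_bellmanIterate [StandardBorelSpace U]
    (hf : Continuous fun p : EuclideanSpace ℝ (Fin d) × U × ℝ => f p.1 p.2.1 p.2.2) (c₀ : ℝ≥0)
    {ℓ : EuclideanSpace ℝ (Fin d) → ℝ} (hℓ : Measurable ℓ) (t n : ℕ) :
    UniversallyMeasurable (bellmanIterate f c₀ ℓ t n) :=
  (lowerSemianalytic_bellmanIterate hf c₀ hℓ t n).universallyMeasurable

theorem stepExpectation_eq_eintegral_meanTransition
    (hf : Continuous fun p : EuclideanSpace ℝ (Fin d) × U × ℝ => f p.1 p.2.1 p.2.2) (c₀ : ℝ≥0)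
    (t : ℕ) {W : State d → EReal} (hW : UniversallyMeasurable W) (x : State d) (u : U) :
    stepExpectation f c₀ t W x u = eintegral (meanTransition f c₀ t x u) W := by
  have := isProbabilityMeasure_meanTransition hf c₀ t x u
  exact (eintegral_map (measurable_stateUpdate_right hf c₀ t x u).aemeasurable
    (hW.aemeasurable (meanTransition f c₀ t x u))).symm

/-- Fubini's theorem for one step of the process under a policy. -/
theorem eintegral_bind_policyStep
    (hf : Continuous fun p : EuclideanSpace ℝ (Fin d) × U × ℝ => f p.1 p.2.1 p.2.2) (c₀ : ℝ≥0)
    (φ : Policy d U) (t : ℕ) (μ : Measure (State d)) [IsProbabilityMeasure μ]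
    {W : State d → EReal} (hW : UniversallyMeasurable W)
    (h : ∫⁻ x, (W x).toENNReal ∂(μ.bind (policyStep f c₀ φ t)) < ⊤ ∨
      ∫⁻ x, (-W x).toENNReal ∂(μ.bind (policyStep f c₀ φ t)) < ⊤) :
    eintegral (μ.bind (policyStep f c₀ φ t)) W
      = eintegral μ fun x => stepExpectation f c₀ t W x (φ.1 t x) := by
  have := isProbabilityMeasure_bind_policyStep hf c₀ φ t μ
  rw [eintegral_bind (aemeasurable_policyStep hf c₀ φ t μ) (hW.aemeasurable _) h]
  simp_rw [stepExpectation_eq_eintegral_meanTransition hf c₀ t hW]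
  rfl

/-- If the positive part has infinite integral after the step, the right-hand side is `⊤` by
convention; otherwise Fubini's theorem applies. Either way no well-posedness is needed. -/
theorem eintegral_bellmanIterate_succ_le [StandardBorelSpace U]
    (hf : Continuous fun p : EuclideanSpace ℝ (Fin d) × U × ℝ => f p.1 p.2.1 p.2.2) (c₀ : ℝ≥0)
    {ℓ : EuclideanSpace ℝ (Fin d) → ℝ} (hℓ : Measurable ℓ) (φ : Policy d U) (n t : ℕ)
    (μ : Measure (State d)) [IsProbabilityMeasure μ] :
    eintegral μ (bellmanIterate f c₀ ℓ t (n + 1))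
      ≤ eintegral (μ.bind (policyStep f c₀ φ t)) (bellmanIterate f c₀ ℓ (t + 1) n) := by
  by_cases h : ∫⁻ x, (bellmanIterate f c₀ ℓ (t + 1) n x).toENNReal
      ∂(μ.bind (policyStep f c₀ φ t)) = ⊤
  · rw [eintegral_eq_extSub _ (bellmanIterate f c₀ ℓ (t + 1) n), h, extSub_top]
    exact le_top
  · rw [eintegral_bind_policyStep hf c₀ φ t μ
      (universallyMeasurable_bellmanIterate hf c₀ hℓ (t + 1) n) (Or.inl (lt_top_iff_ne_top.2 h))]
    exact eintegral_mono_ae (ae_of_all _ fun x => iInf_le _ (φ.1 t x))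

/-- The solution of the Bellman equations is a lower bound for the expected loss. -/
theorem eintegral_bellmanIterate_le [StandardBorelSpace U]
    (hf : Continuous fun p : EuclideanSpace ℝ (Fin d) × U × ℝ => f p.1 p.2.1 p.2.2) (c₀ : ℝ≥0)
    {ℓ : EuclideanSpace ℝ (Fin d) → ℝ} (hℓ : Measurable ℓ) (φ : Policy d U) (n t : ℕ)
    (μ : Measure (State d)) [IsProbabilityMeasure μ] :
    eintegral μ (bellmanIterate f c₀ ℓ t n)
      ≤ eintegral (μ.bind (stateLaw f c₀ φ n t)) fun x => (ℓ x.1 : EReal) := by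
  induction n generalizing t μ with
  | zero => rw [bind_stateLaw_zero]; rfl
  | succ n ih =>
    have := isProbabilityMeasure_bind_policyStep hf c₀ φ t μ
    rw [bind_stateLaw_succ hf]
    exact (eintegral_bellmanIterate_succ_le hf c₀ hℓ φ n t μ).trans (ih (t + 1) _)

open Classical in
/-- The policy that uses `ψ` at time `t` and follows `φ` at all other times. -/
def Policy.update (φ : Policy d U) (t : ℕ) {ψ : State d → U} (hψ : UniversallyMeasurable ψ) :
    Policy d U :=
  ⟨fun s => if s = t then ψ else φ.1 s, fun s => by
    dsimp only
    split_ifs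
    · exact hψ
    · exact φ.2 s⟩

theorem bind_stateLaw_update
    (hf : Continuous fun p : EuclideanSpace ℝ (Fin d) × U × ℝ => f p.1 p.2.1 p.2.2) (c₀ : ℝ≥0)
    (φ ψ : Policy d U) (n t : ℕ) (μ : Measure (State d)) [IsProbabilityMeasure μ] :
    μ.bind (stateLaw f c₀ (φ.update t (ψ.2 t)) (n + 1) t)
      = (μ.bind (policyStep f c₀ ψ t)).bind (stateLaw f c₀ φ n (t + 1)) := by
  rw [bind_stateLaw_succ hf]
  have h1 : policyStep f c₀ (φ.update t (ψ.2 t)) t = policyStep f c₀ ψ t := by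
    funext x
    simp [policyStep, Policy.update]
  have h2 : stateLaw f c₀ (φ.update t (ψ.2 t)) n (t + 1) = stateLaw f c₀ φ n (t + 1) := by
    refine stateLaw_congr n (t + 1) fun s hs => ?_
    simp only [Policy.update]
    rw [if_neg (by omega)]
  rw [h1, h2]

/-- A class of initial distributions, closed under the dynamics, on which the values of the Bellman
equations have well-defined integrals. -/
structure IsAdmissibleClass (f : EuclideanSpace ℝ (Fin d) → U → ℝ → EuclideanSpace ℝ (Fin d))
    (c₀ : ℝ≥0) (ℓ : EuclideanSpace ℝ (Fin d) → ℝ)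
    (C : ℕ → ℕ → Measure (State d) → Prop) : Prop where
  step : ∀ n t μ [IsProbabilityMeasure μ], C (n + 1) t μ → ∀ φ : Policy d U,
    C n (t + 1) (μ.bind (policyStep f c₀ φ t))
  integrable : ∀ n t μ [IsProbabilityMeasure μ], C n t μ →
    ∫⁻ x, (bellmanIterate f c₀ ℓ t n x).toENNReal ∂μ < ⊤ ∨
      ∫⁻ x, (-bellmanIterate f c₀ ℓ t n x).toENNReal ∂μ < ⊤

/-- Approximately optimal policies from an admissible initial distribution. -/
theorem IsAdmissibleClass.exists_policy_lt [StandardBorelSpace U] [Nonempty U]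
    (hf : Continuous fun p : EuclideanSpace ℝ (Fin d) × U × ℝ => f p.1 p.2.1 p.2.2) {c₀ : ℝ≥0}
    {ℓ : EuclideanSpace ℝ (Fin d) → ℝ} (hℓ : Measurable ℓ)
    {C : ℕ → ℕ → Measure (State d) → Prop} (hC : IsAdmissibleClass f c₀ ℓ C) (n t : ℕ)
    (μ : Measure (State d)) [IsProbabilityMeasure μ] (hμ : C n t μ) {r : EReal}
    (hr : eintegral μ (bellmanIterate f c₀ ℓ t n) < r) :
    ∃ φ : Policy d U, eintegral (μ.bind (stateLaw f c₀ φ n t)) (fun x => (ℓ x.1 : EReal)) < r := by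
  let φ₀ : Policy d U :=
    ⟨fun _ _ => Classical.arbitrary U, fun _ => measurable_const.universallyMeasurable⟩
  induction n generalizing t μ with
  | zero =>
    refine ⟨φ₀, ?_⟩
    rw [bind_stateLaw_zero]
    exact hr
  | succ n ih =>
    have hW := lowerSemianalytic_bellmanIterate hf c₀ hℓ (t + 1) n
    -- A Borel strict majorant takes the place of `W + ε`. It also covers the value `-∞` and leaves
    -- an analytic set of admissible actions, from which `ψ` is selected.
    obtain ⟨h, hh, hlt, hint⟩ := exists_gt_eintegral_lt
      ((universallyMeasurable_bellmanIterate hf c₀ hℓ t (n + 1)).aemeasurable μ) hr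
    obtain ⟨ψ, hψ, hψD⟩ := ((hW.stepExpectation hf c₀ t).souslin_lt
      (h := fun p => ((h p.1 : ℝ) : EReal))
      (hh.comp measurable_fst).coe_real_ereal).exists_universallyMeasurable_selector
    let φ₁ : Policy d U := φ₀.update t hψ
    have hφ₁ : φ₁.1 t = ψ := by simp [φ₁, Policy.update]
    have := isProbabilityMeasure_bind_policyStep hf c₀ φ₁ t μ
    have hν := hC.step n t μ hμ φ₁
    obtain ⟨φ, hφ⟩ := ih (t + 1) (μ.bind (policyStep f c₀ φ₁ t)) hν (by
      rw [eintegral_bind_policyStep hf c₀ φ₁ t μ hW.universallyMeasurable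
        (hC.integrable n (t + 1) _ hν)]
      refine lt_of_le_of_lt (eintegral_mono_ae ?_) hint
      filter_upwards [hlt] with x hx
      obtain ⟨u, hu⟩ := iInf_lt_iff.1 hx
      rw [hφ₁]
      exact le_of_lt (hψD x u hu))
    -- The nearly optimal action at time `t` is followed by the policy that the induction gives for
    -- the law at time `t + 1`.
    refine ⟨φ.update t (φ₁.2 t), ?_⟩
    rwa [bind_stateLaw_update hf c₀]

/-- Selectors in the Bellman equations are optimal from an admissible initial distribution. -/
theorem IsAdmissibleClass.eintegral_selector_le [StandardBorelSpace U]
    (hf : Continuous fun p : EuclideanSpace ℝ (Fin d) × U × ℝ => f p.1 p.2.1 p.2.2) {c₀ : ℝ≥0}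
    {ℓ : EuclideanSpace ℝ (Fin d) → ℝ} (hℓ : Measurable ℓ)
    {C : ℕ → ℕ → Measure (State d) → Prop} (hC : IsAdmissibleClass f c₀ ℓ C) (φ : Policy d U)
    (n t : ℕ)
    (hφ : ∀ m s, s + m + 1 = t + n → ∀ x, stepExpectation f c₀ s (bellmanIterate f c₀ ℓ (s + 1) m)
      x (φ.1 s x) = bellmanIterate f c₀ ℓ s (m + 1) x)
    (μ : Measure (State d)) [IsProbabilityMeasure μ] (hμ : C n t μ) :
    eintegral (μ.bind (stateLaw f c₀ φ n t)) (fun x => (ℓ x.1 : EReal))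
      ≤ eintegral μ (bellmanIterate f c₀ ℓ t n) := by
  induction n generalizing t μ with
  | zero => rw [bind_stateLaw_zero]; rfl
  | succ n ih =>
    have := isProbabilityMeasure_bind_policyStep hf c₀ φ t μ
    have hν := hC.step n t μ hμ φ
    rw [bind_stateLaw_succ hf]
    refine (ih (t + 1) (fun m s hms => hφ m s (by omega)) _ hν).trans ?_
    rw [eintegral_bind_policyStep hf c₀ φ t μ
      (universallyMeasurable_bellmanIterate hf c₀ hℓ (t + 1) n) (hC.integrable n (t + 1) _ hν)]
    exact eintegral_mono_ae (ae_of_all _ fun x => (hφ n t (by omega) x).le)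

/-- One step under `ψ` followed by `φ` is again a policy, which gives closure. Integrability follows
by comparing the Bellman value with the loss of any single policy. -/
theorem isAdmissibleClass_of_pos [StandardBorelSpace U] [Nonempty U]
    (hf : Continuous fun p : EuclideanSpace ℝ (Fin d) × U × ℝ => f p.1 p.2.1 p.2.2) (c₀ : ℝ≥0)
    {ℓ : EuclideanSpace ℝ (Fin d) → ℝ} (hℓ : Measurable ℓ) :
    IsAdmissibleClass f c₀ ℓ fun n t μ => ∀ φ : Policy d U,
      ∫⁻ x, ENNReal.ofReal (ℓ x.1) ∂(μ.bind (stateLaw f c₀ φ n t)) < ⊤ where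
  step n t μ _ h ψ φ := by
    rw [← bind_stateLaw_update hf c₀]
    exact h _
  integrable n t μ _ h := by
    let φ₀ : Policy d U :=
      ⟨fun _ _ => Classical.arbitrary U, fun _ => measurable_const.universallyMeasurable⟩
    exact Or.inl (lintegral_lt_top_of_eintegral_lt_top
      ((eintegral_bellmanIterate_le hf c₀ hℓ φ₀ n t μ).trans_lt (extSub_lt_top.2 (h φ₀))))

theorem bellmanIterate_mono (c₀ : ℝ≥0) {ℓ ℓ' : EuclideanSpace ℝ (Fin d) → ℝ} (h : ∀ y, ℓ y ≤ ℓ' y)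
    (t n : ℕ) (x : State d) : bellmanIterate f c₀ ℓ t n x ≤ bellmanIterate f c₀ ℓ' t n x := by
  induction n generalizing t x with
  | zero => exact EReal.coe_le_coe_iff.2 (h x.1)
  | succ n ih =>
    exact iInf_mono fun u => eintegral_mono_ae (ae_of_all _ fun z => ih (t + 1) _)

theorem bellmanIterate_nonpos [Nonempty U] (c₀ : ℝ≥0) {ℓ : EuclideanSpace ℝ (Fin d) → ℝ}
    (h : ∀ y, ℓ y ≤ 0) (t n : ℕ) (x : State d) : bellmanIterate f c₀ ℓ t n x ≤ 0 := by
  induction n generalizing t x with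
  | zero => exact EReal.coe_le_coe_iff.2 (h x.1)
  | succ n ih =>
    refine (iInf_le _ (Classical.arbitrary U)).trans ?_
    refine (eintegral_mono_ae (g := fun _ => 0) (ae_of_all _ fun z => ih (t + 1) _)).trans ?_
    simp [eintegral]

theorem eintegral_of_nonpos {α : Type*} [MeasurableSpace α] {μ : Measure α} {g : α → EReal}
    (h : ∀ x, g x ≤ 0) : eintegral μ g = -((∫⁻ x, (-g x).toENNReal ∂μ : ℝ≥0∞) : EReal) := by
  have : ∫⁻ x, (g x).toENNReal ∂μ = 0 := by
    simp [fun x => EReal.toENNReal_of_nonpos (h x)]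
  rw [eintegral_eq_extSub, this, extSub_of_ne_top ENNReal.zero_ne_top]
  simp

/-- The Bellman value of the truncated loss `min ℓ 0` lies below the original one. The truncated
problem has no positive part, so it admits nearly optimal policies by the previous class; a negative
part exceeding the supremum `S` would then yield a policy whose negative part exceeds `S`. -/
theorem isAdmissibleClass_of_neg [StandardBorelSpace U] [Nonempty U]
    (hf : Continuous fun p : EuclideanSpace ℝ (Fin d) × U × ℝ => f p.1 p.2.1 p.2.2) (c₀ : ℝ≥0)
    {ℓ : EuclideanSpace ℝ (Fin d) → ℝ} (hℓ : Measurable ℓ) :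
    IsAdmissibleClass f c₀ ℓ fun n t μ => (⨆ φ : Policy d U,
      ∫⁻ x, ENNReal.ofReal (-ℓ x.1) ∂(μ.bind (stateLaw f c₀ φ n t))) < ⊤ where
  step n t μ _ h ψ := by
    refine lt_of_le_of_lt (iSup_le fun φ => ?_) h
    rw [← bind_stateLaw_update hf c₀]
    exact le_iSup (fun φ : Policy d U =>
      ∫⁻ x, ENNReal.ofReal (-ℓ x.1) ∂(μ.bind (stateLaw f c₀ φ (n + 1) t))) _
  integrable n t μ _ h := by
    refine Or.inr ?_
    set S := ⨆ φ : Policy d U, ∫⁻ x, ENNReal.ofReal (-ℓ x.1) ∂(μ.bind (stateLaw f c₀ φ n t))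
      with hS
    let m : EuclideanSpace ℝ (Fin d) → ℝ := fun y => min (ℓ y) 0
    have hm : Measurable m := hℓ.min measurable_const
    have hm0 : ∀ y, m y ≤ 0 := fun y => min_le_right _ _
    have hle : ∫⁻ x, (-bellmanIterate f c₀ ℓ t n x).toENNReal ∂μ
        ≤ ∫⁻ x, (-bellmanIterate f c₀ m t n x).toENNReal ∂μ :=
      lintegral_mono fun x => EReal.toENNReal_le_toENNReal
        (EReal.neg_le_neg_iff.2 (bellmanIterate_mono c₀ (fun y => min_le_left _ _) t n x))
    refine hle.trans_lt (lt_of_le_of_lt ?_ h)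
    by_contra! hlt
    have hadm : ∀ φ : Policy d U,
        ∫⁻ x, ENNReal.ofReal (m x.1) ∂(μ.bind (stateLaw f c₀ φ n t)) < ⊤ := by
      intro φ
      simp [fun x : State d => ENNReal.ofReal_of_nonpos (hm0 x.1)]
    obtain ⟨φ, hφ⟩ := (isAdmissibleClass_of_pos hf c₀ hm).exists_policy_lt hf hm n t μ hadm
      (r := -(S : EReal)) (by
        rw [eintegral_of_nonpos (bellmanIterate_nonpos c₀ hm0 t n), EReal.neg_lt_neg_iff]
        exact_mod_cast hlt)
    rw [eintegral_of_nonpos (g := fun x : State d => (m x.1 : EReal))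
      (fun x => EReal.coe_le_coe_iff.2 (hm0 x.1)), EReal.neg_lt_neg_iff] at hφ
    have hφ' : S < ∫⁻ x, (-(m x.1 : EReal)).toENNReal ∂(μ.bind (stateLaw f c₀ φ n t)) := by
      exact_mod_cast hφ
    refine hφ'.not_ge (le_trans (le_of_eq ?_) (le_iSup (fun φ : Policy d U =>
      ∫⁻ x, ENNReal.ofReal (-ℓ x.1) ∂(μ.bind (stateLaw f c₀ φ n t))) φ))
    refine lintegral_congr fun x => ?_
    rw [← EReal.coe_neg, EReal.real_coe_toENNReal]
    rcases le_total (ℓ x.1) 0 with h | h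
    · simp [m, h]
    · simp [m, h, ENNReal.ofReal_of_nonpos]

/-- The infimum over policies of the expected loss from an admissible distribution concentrated at
a single state. -/
theorem IsAdmissibleClass.iInf_eq [StandardBorelSpace U] [Nonempty U]
    (hf : Continuous fun p : EuclideanSpace ℝ (Fin d) × U × ℝ => f p.1 p.2.1 p.2.2) {c₀ : ℝ≥0}
    {ℓ : EuclideanSpace ℝ (Fin d) → ℝ} (hℓ : Measurable ℓ)
    {C : ℕ → ℕ → Measure (State d) → Prop} (hC : IsAdmissibleClass f c₀ ℓ C) (n t : ℕ)
    (x : State d) (hx : C n t (Measure.dirac x)) :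
    ⨅ φ : Policy d U, eintegral (stateLaw f c₀ φ n t x) (fun x => (ℓ x.1 : EReal))
      = bellmanIterate f c₀ ℓ t n x := by
  refine le_antisymm (le_of_forall_gt fun r hr => ?_) (le_iInf fun φ => ?_)
  · obtain ⟨φ, hφ⟩ := hC.exists_policy_lt hf hℓ n t (Measure.dirac x) hx (r := r)
      (by rwa [eintegral_dirac])
    rw [dirac_bind_of_singleton] at hφ
    exact (iInf_le _ φ).trans_lt hφ
  · have := eintegral_bellmanIterate_le hf c₀ hℓ φ n t (Measure.dirac x)
    rwa [eintegral_dirac, dirac_bind_of_singleton] at this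

theorem IsAdmissibleClass.selector_eq [StandardBorelSpace U]
    (hf : Continuous fun p : EuclideanSpace ℝ (Fin d) × U × ℝ => f p.1 p.2.1 p.2.2) {c₀ : ℝ≥0}
    {ℓ : EuclideanSpace ℝ (Fin d) → ℝ} (hℓ : Measurable ℓ)
    {C : ℕ → ℕ → Measure (State d) → Prop} (hC : IsAdmissibleClass f c₀ ℓ C) (φ : Policy d U)
    (n t : ℕ)
    (hφ : ∀ m s, s + m + 1 = t + n → ∀ x, stepExpectation f c₀ s (bellmanIterate f c₀ ℓ (s + 1) m)
      x (φ.1 s x) = bellmanIterate f c₀ ℓ s (m + 1) x)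
    (x : State d) (hx : C n t (Measure.dirac x)) :
    eintegral (stateLaw f c₀ φ n t x) (fun x => (ℓ x.1 : EReal))
      = bellmanIterate f c₀ ℓ t n x := by
  have h1 := hC.eintegral_selector_le hf hℓ φ n t hφ (Measure.dirac x) hx
  have h2 := eintegral_bellmanIterate_le hf c₀ hℓ φ n t (Measure.dirac x)
  rw [eintegral_dirac, dirac_bind_of_singleton] at h1 h2
  exact le_antisymm h1 h2

/-- Since the Bellman value is only shown to be universally measurable in `x`, the selection is not
made directly among minimizers. The value becomes an extra variable `v`: a selector is found for the
analytic set of `((x, v), u)` with one-step expectation at most `v`, and `v` is then replaced by the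
Bellman value at `x`. -/
theorem exists_isBellmanSelector [StandardBorelSpace U] [Nonempty U]
    (hf : Continuous fun p : EuclideanSpace ℝ (Fin d) × U × ℝ => f p.1 p.2.1 p.2.2) (c₀ : ℝ≥0)
    {ℓ : EuclideanSpace ℝ (Fin d) → ℝ} (hℓ : Measurable ℓ) (T : ℕ)
    (h : ∀ t < T, ∀ x : State d, ∃ u : U,
      stepExpectation f c₀ t (bellmanValue f c₀ T ℓ (t + 1)) x u = bellmanValue f c₀ T ℓ t x) :
    ∃ φ : Policy d U, IsBellmanSelector f c₀ T ℓ φ := by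
  have key : ∀ t < T, ∃ ψ : State d → U, UniversallyMeasurable ψ ∧ ∀ x,
      stepExpectation f c₀ t (bellmanValue f c₀ T ℓ (t + 1)) x (ψ x)
        = bellmanValue f c₀ T ℓ t x := by
    intro t ht
    have hJ := (lowerSemianalytic_bellmanIterate hf c₀ hℓ (t + 1) (T - (t + 1))).stepExpectation
      hf c₀ t
    have hJ' := hJ.comp (g := fun p : (State d × EReal) × U => (p.1.1, p.2)) (by fun_prop)
    obtain ⟨ψ, hψ, hψD⟩ := (hJ'.souslin_le (h := fun p => p.1.2)
      (by fun_prop)).exists_universallyMeasurable_selector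
    refine ⟨fun x => ψ (x, bellmanValue f c₀ T ℓ t x), hψ.comp
      (measurable_id.universallyMeasurable.prodMk
        (universallyMeasurable_bellmanIterate hf c₀ hℓ t (T - t))), fun x => le_antisymm ?_ ?_⟩
    · obtain ⟨u, hu⟩ := h t ht x
      exact hψD (x, bellmanValue f c₀ T ℓ t x) u hu.le
    · rw [bellmanValue_of_lt f c₀ T ℓ ht]
      exact iInf_le _ _
  choose! ψ hψ hψW using key
  refine ⟨⟨fun t => if t < T then ψ t else fun _ => Classical.arbitrary U, fun t => ?_⟩,
    fun t ht x => ?_⟩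
  · dsimp only
    split_ifs with ht
    · exact hψ t ht
    · exact measurable_const.universallyMeasurable
  · simp only [if_pos ht]
    exact hψW t ht x

end DynamicProgramming

/-! ### Reduction of path-space expectations to the law of the terminal state -/

section Value

variable {d k : ℕ} {U : Set (EuclideanSpace ℝ (Fin k))}
  {f : EuclideanSpace ℝ (Fin d) → U → ℝ → EuclideanSpace ℝ (Fin d)}

theorem measurable_last_finCons {n : ℕ} (x : State d) :
    Measurable fun ω : Fin n → State d => (Fin.cons x ω : Fin (n + 1) → State d) (Fin.last n) :=
  (measurable_pi_apply (Fin.last n)).comp (measurable_finCons x)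

theorem costToGo_eq
    (hf : Continuous fun p : EuclideanSpace ℝ (Fin d) × U × ℝ => f p.1 p.2.1 p.2.2) {c₀ : ℝ≥0}
    (hc₀ : 0 < c₀) {ℓ : EuclideanSpace ℝ (Fin d) → ℝ} (hℓ : Measurable ℓ) (T t : ℕ) (x : State d)
    (φ : Policy d U) :
    costToGo f c₀ T ℓ t x φ
      = eintegral (stateLaw f c₀ φ (T - t) t x) (fun x => (ℓ x.1 : EReal)) := by
  rw [← map_last_futureLaw hf hc₀]
  exact (eintegral_map (measurable_last_finCons x).aemeasurable
    (hℓ.comp measurable_fst).coe_real_ereal.aemeasurable).symm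

theorem expectedLoss_eq_costToGo {c₀ : ℝ≥0} {ℓ : EuclideanSpace ℝ (Fin d) → ℝ} (hℓ : Measurable ℓ)
    (T : ℕ) (x : State d) (φ : Policy d U) :
    expectedLoss f c₀ T ℓ φ x = costToGo f c₀ T ℓ 0 x φ := by
  have hm : Measurable fun ω : Fin (T + 1) → State d => (ℓ (ω (Fin.last T)).1 : EReal) :=
    (hℓ.comp (measurable_fst.comp (measurable_pi_apply _))).coe_real_ereal
  rw [expectedLoss, canonicalLaw, dirac_bind_of_singleton,
    eintegral_map (measurable_finCons x).aemeasurable hm.aemeasurable]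
  rfl

theorem lintegral_terminalState
    (hf : Continuous fun p : EuclideanSpace ℝ (Fin d) × U × ℝ => f p.1 p.2.1 p.2.2) {c₀ : ℝ≥0}
    (hc₀ : 0 < c₀) {g : EuclideanSpace ℝ (Fin d) → ℝ≥0∞} (hg : Measurable g) (n t : ℕ)
    (x : State d) (φ : Policy d U) :
    ∫⁻ ω, g (terminalState x ω) ∂(futureLaw f c₀ φ t n x)
      = ∫⁻ y, g y.1 ∂((Measure.dirac x).bind (stateLaw f c₀ φ n t)) := by
  rw [dirac_bind_of_singleton, ← map_last_futureLaw hf hc₀]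
  exact (lintegral_map (hg.comp measurable_fst) (measurable_last_finCons x)).symm

/-- Well posed states carry an admissible point mass. -/
theorem WellPosed.exists_isAdmissibleClass [StandardBorelSpace U] [Nonempty U]
    (hf : Continuous fun p : EuclideanSpace ℝ (Fin d) × U × ℝ => f p.1 p.2.1 p.2.2) {c₀ : ℝ≥0}
    (hc₀ : 0 < c₀) {ℓ : EuclideanSpace ℝ (Fin d) → ℝ} (hℓ : Measurable ℓ) {T t : ℕ} {x : State d}
    (h : WellPosed f c₀ T ℓ t x) :
    ∃ C, IsAdmissibleClass f c₀ ℓ C ∧ C (T - t) t (Measure.dirac x) := by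
  rcases h with h | h
  · refine ⟨_, isAdmissibleClass_of_pos hf c₀ hℓ, fun φ => ?_⟩
    rw [← lintegral_terminalState hf hc₀ hℓ.ennreal_ofReal]
    exact h φ
  · refine ⟨_, isAdmissibleClass_of_neg hf c₀ hℓ, ?_⟩
    simp_rw [← lintegral_terminalState hf hc₀ (g := fun y => ENNReal.ofReal (-ℓ y))
      hℓ.neg.ennreal_ofReal]
    exact h

end Value

end BayesControl

open BayesControl in
theorem theorem4p3 {d k : ℕ} (T : ℕ)
    (U : Set (EuclideanSpace ℝ (Fin k))) (hU : IsCompact U) (hU_nonempty : U.Nonempty)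
    (f : EuclideanSpace ℝ (Fin d) → U → ℝ → EuclideanSpace ℝ (Fin d))
    (hf : Continuous fun p : EuclideanSpace ℝ (Fin d) × U × ℝ => f p.1 p.2.1 p.2.2)
    (ℓ : EuclideanSpace ℝ (Fin d) → ℝ) (hℓ : Measurable ℓ)
    (c₀ : ℝ≥0) (hc₀ : 0 < c₀) :
    -- the value of the control problem is given by the Bellman equations
    (∀ x₀ : State d, WellPosed f c₀ T ℓ 0 x₀ →
      problemValue f c₀ T ℓ x₀ = optimalCost f c₀ T ℓ 0 x₀ ∧
      optimalCost f c₀ T ℓ 0 x₀ = bellmanValue f c₀ T ℓ 0 x₀) ∧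
    (∀ t ≤ T, ∀ x : State d, WellPosed f c₀ T ℓ t x →
      optimalCost f c₀ T ℓ t x = bellmanValue f c₀ T ℓ t x) ∧
    -- universally measurable selectors form an optimal policy, at every time and state
    (∀ φ : Policy d U, IsBellmanSelector f c₀ T ℓ φ →
      (∀ x₀ : State d, WellPosed f c₀ T ℓ 0 x₀ →
        expectedLoss f c₀ T ℓ φ x₀ = problemValue f c₀ T ℓ x₀) ∧
      (∀ t ≤ T, ∀ x : State d, WellPosed f c₀ T ℓ t x →
        costToGo f c₀ T ℓ t x φ = optimalCost f c₀ T ℓ t x ∧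
        optimalCost f c₀ T ℓ t x = bellmanValue f c₀ T ℓ t x)) ∧
    -- such selectors exist as soon as the infima in the Bellman equations are attained
    ((∀ t < T, ∀ x : State d, ∃ u : U,
        stepExpectation f c₀ t (bellmanValue f c₀ T ℓ (t + 1)) x u
          = bellmanValue f c₀ T ℓ t x) →
      ∃ φ : Policy d U, IsBellmanSelector f c₀ T ℓ φ) := by
  have : StandardBorelSpace U := hU.measurableSet.standardBorel
  have : Nonempty U := hU_nonempty.to_subtype
  have hvalue : ∀ x₀, problemValue f c₀ T ℓ x₀ = optimalCost f c₀ T ℓ 0 x₀ := fun x₀ =>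
    iInf_congr fun φ => expectedLoss_eq_costToGo hℓ T x₀ φ
  have hopt : ∀ t ≤ T, ∀ x : State d, WellPosed f c₀ T ℓ t x →
      optimalCost f c₀ T ℓ t x = bellmanValue f c₀ T ℓ t x := by
    intro t _ x hx
    obtain ⟨C, hC, hCx⟩ := hx.exists_isAdmissibleClass hf hc₀ hℓ
    rw [optimalCost, iInf_congr (costToGo_eq hf hc₀ hℓ T t x)]
    exact hC.iInf_eq hf hℓ (T - t) t x hCx
  have hsel : ∀ φ : Policy d U, IsBellmanSelector f c₀ T ℓ φ → ∀ t ≤ T, ∀ x : State d,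
      WellPosed f c₀ T ℓ t x → costToGo f c₀ T ℓ t x φ = optimalCost f c₀ T ℓ t x := by
    intro φ hφ t ht x hx
    obtain ⟨C, hC, hCx⟩ := hx.exists_isAdmissibleClass hf hc₀ hℓ
    rw [hopt t ht x hx, costToGo_eq hf hc₀ hℓ]
    refine hC.selector_eq hf hℓ φ (T - t) t (fun m s hms y => ?_) x hCx
    have h := hφ s (by omega) y
    rwa [bellmanValue, bellmanValue, show T - (s + 1) = m by omega,
      show T - s = m + 1 by omega] at h
  refine ⟨fun x₀ hx₀ => ⟨hvalue x₀, hopt 0 T.zero_le x₀ hx₀⟩, hopt, fun φ hφ =>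
    ⟨fun x₀ hx₀ => ?_, fun t ht x hx => ⟨hsel φ hφ t ht x hx, hopt t ht x hx⟩⟩,
    exists_isBellmanSelector hf c₀ hℓ T⟩
  rw [expectedLoss_eq_costToGo hℓ, hvalue, hsel φ hφ 0 T.zero_le x₀ hx₀]
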